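/- Let $\mathbb K$ be a field, $d\ge 0$ an integer, $\mathrm{Mat}_{d+1}(\mathbb K)$ the algebra of $(d+1)\times(d+1)$ matrices over $\mathbb K$ (rows and columns indexed by $0,\dots,d$), $\mathcal A$ a $\mathbb K$-algebra isomorphic to $\mathrm{Mat}_{d+1}(\mathbb K)$, and $V$ a simple left $\mathcal A$-module. **Definitions.** If $A\in\mathcal A$ has $d+1$ distinct eigenvalues $\theta_0,\dots,\theta_d$ in $\mathbb K$, its primitive idempotent for $\theta_i$ is $E_i=\prod_{j\ne i}(A-\theta_jI)/(\theta_i-\theta_j)$. A *Leonard system* in $\mathcal A$ is a sequence $\Phi=(A;\{E_i\}_{i=0}^d;A^*;\{E^*_i\}_{i=0}^d)$ such that each of $A,A^*\in\mathcal A$ has $d+1$ distinct eigenvalues in $\mathbb K$, $\{E_i\}$ and $\{E_i^*\}$ are orderings of the primitive idempotents of $A$ and $A^*$ respectively, and both $E_iA^*E_j$ and $E^*_iAE^*_j$ are $0$ if $|i-j|>1$ and nonzero if $|i-j|=1$. Then $\Phi^*=(A^*;\{E^*_i\};A;\{E_i\})$ is also a Leonard system. Let $\theta_i$ (resp. $\theta^*_i$)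 be the eigenvalue of $A$ (resp. $A^*$) for $E_i$ (resp. $E^*_i$), and for $0\le i\le d$ put $$\tau_i=(\lambda-\theta_0)\cdots(\lambda-\theta_{i-1}),\qquad \eta_i=(\lambda-\theta_d)\cdots(\lambda-\theta_{d-i+1}).$$ The first and second split sequences of $\Phi$ are, for $1\le i\le d$, $$\varphi_i=(\theta^*_0-\theta^*_i)\frac{\mathrm{tr}(\tau_i(A)E^*_0)}{\mathrm{tr}(\tau_{i-1}(A)E^*_0)},\qquad \phi_i=(\theta^*_0-\theta^*_i)\frac{\mathrm{tr}(\eta_i(A)E^*_0)}{\mathrm{tr}(\eta_{i-1}(A)E^*_0)}.$$ The switching element of $\Phi$ is $S=\sum_{r=0}^d\frac{\phi_d\phi_{d-1}\cdots\phi_{d-r+1}}{\varphi_1\varphi_2\cdots\varphi_r}E_r$; the *dual switching element* $S^*$ of $\Phi$ is the switching element of $\Phi^*$. Let $q$ be a nonzero element of an extension field of $\mathbb K$ (for instance of its algebraic closure) such that, if $d\ge 3$, $q+q^{-1}+1=(\theta_0-\theta_3)/(\theta_1-\theta_2)$, which is the common value of $(\theta_{i-2}-\theta_{i+1})/(\theta_{i-1}-\theta_i)$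 and $(\theta^*_{i-2}-\theta^*_{i+1})/(\theta^*_{i-1}-\theta^*_i)$ for $2\le i\le d-1$; if $d\le 2$, $q$ is arbitrary nonzero. For nonnegative integers $r,s,t$ with $r+s+t\le d$ and $q\ne\pm1$ put $$[r,s,t]_q=\frac{(q;q)_{r+s}(q;q)_{r+t}(q;q)_{s+t}}{(q;q)_r(q;q)_s(q;q)_t(q;q)_{r+s+t}},\qquad (q;q)_n=\prod_{k=1}^n(1-q^k).$$ If $q=-1$ (including $q=1$ in characteristic $2$), put $[r,s,t]_q=0$ when $r,s,t$ are all odd and otherwise $$[r,s,t]_q=\frac{\lfloor\frac{r+s}2\rfloor!\,\lfloor\frac{r+t}2\rfloor!\,\lfloor\frac{s+t}2\rfloor!}{\lfloor\frac r2\rfloor!\,\lfloor\frac s2\rfloor!\,\lfloor\frac t2\rfloor!\,\lfloor\frac{r+s+t}2\rfloor!}.$$ If $q=1\neq-1$, put $[r,s,t]_q=\frac{(r+s)!\,(r+t)!\,(s+t)!}{r!\,s!\,t!\,(r+s+t)!}$. **Theorem.** (1) Let $\Phi$ be a Leonard system in $\mathcal A$ and fix a nonzero $v\in E^*_0V$.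 Then $\tau_0(A)v,\dots,\tau_d(A)v$ is a basis of $V$ and $S^*$ is invertible. For $X\in\mathcal A$ let $X^\natural$ be the matrix representing $X$ with respect to this basis, that is, $X\tau_j(A)v=\sum_iX^\natural_{ij}\tau_i(A)v$. Then $S^{*\natural}$ and $(S^{*-1})^\natural$ are upper triangular, and for $0\le i\le j\le d$ $$S^{*\natural}_{ij}=\frac{[i,j-i,d-j]_q\,\phi_1\cdots\phi_i\,\tau_{j-i}(\theta_d)}{\varphi_1\cdots\varphi_i},\qquad (S^{*-1})^\natural_{ij}=\frac{[i,j-i,d-j]_q\,\varphi_1\cdots\varphi_j\,\eta_{j-i}(\theta_0)}{\phi_1\cdots\phi_j}.$$ (2) (Matrix form.) Let $A\in\mathrm{Mat}_{d+1}(\mathbb K)$ be lower bidiagonal with diagonal $\theta_0,\dots,\theta_d$ and all subdiagonal entries $1$, and let $A^*\in\mathrm{Mat}_{d+1}(\mathbb K)$ be upper bidiagonal with diagonal $\theta^*_0,\dots,\theta^*_d$ and superdiagonal $\varphi_1,\dots,\varphi_d$, where the $\theta_i$ are mutually distinct, the $\theta_i^*$ are mutually distinct and all $\varphi_i$ are nonzero.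 Let $E_i$ (resp. $E^*_i$) be the primitive idempotent of $A$ (resp. $A^*$) for $\theta_i$ (resp. $\theta^*_i$), and $\Phi=(A;\{E_i\};A^*;\{E^*_i\})$. Assume that $A,A^*$ is a Leonard pair (there is a basis of $\mathbb K^{d+1}$ in which $A$ is irreducible tridiagonal and $A^*$ is diagonal, and a basis in which $A^*$ is irreducible tridiagonal and $A$ is diagonal; irreducible tridiagonal means that the entries off the diagonal, subdiagonal and superdiagonal are zero and those on the subdiagonal and superdiagonal are all nonzero) or, equivalently, that $\Phi$ is a Leonard system. Then the dual switching element $S^*$ of $\Phi$ is invertible, $S^*$ and $S^{*-1}$ are upper triangular, and for $0\le i\le j\le d$ $$S^{*}_{ij}=\frac{[i,j-i,d-j]_q\,\phi_1\cdots\phi_i\,\tau_{j-i}(\theta_d)}{\varphi_1\cdots\varphi_i},\qquad (S^{*-1})_{ij}=\frac{[i,j-i,d-j]_q\,\varphi_1\cdots\varphi_j\,\eta_{j-i}(\theta_0)}{\phi_1\cdots\phi_j},$$ where $\{\phi_i\}_{i=1}^d$ is the second split sequence of $\Phi$ and $\{\varphi_i\}$ are the superdiagonal entries of $A^*$. -/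

import Mathlib

namespace Leonard

/-! ### Leonard pairs -/

/-- A square matrix is irreducible tridiagonal: entries off the three central diagonals vanish,
and every entry of the subdiagonal and of the superdiagonal is nonzero. -/
def IsIrreducibleTridiagonal {K : Type*} [Field K] {n : ℕ} (M : Matrix (Fin n) (Fin n) K) : Prop :=
  ∀ i j : Fin n,
    (((i : ℕ) + 1 < j ∨ (j : ℕ) + 1 < i) → M i j = 0) ∧
    (((i : ℕ) + 1 = j ∨ (j : ℕ) + 1 = i) → M i j ≠ 0)

/-- `A, B` is a Leonard pair on `V` (so `V` has finite positive dimension): some basis makes `A`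
irreducible tridiagonal and `B` diagonal, and some basis makes `B` irreducible tridiagonal and `A`
diagonal. -/
def IsLeonardPair {K V : Type*} [Field K] [AddCommGroup V] [Module K V]
    (A B : Module.End K V) : Prop :=
  (∃ (n : ℕ) (b : Module.Basis (Fin (n + 1)) K V),
    IsIrreducibleTridiagonal (LinearMap.toMatrix b b A) ∧ (LinearMap.toMatrix b b B).IsDiag) ∧
  (∃ (n : ℕ) (b : Module.Basis (Fin (n + 1)) K V),
    IsIrreducibleTridiagonal (LinearMap.toMatrix b b B) ∧ (LinearMap.toMatrix b b A).IsDiag)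

/-! ### Leonard systems -/

/-- The primitive idempotent `∏_{j ≠ i} (A - θ_j I) / (θ_i - θ_j)` of `A` associated with `θ_i`. -/
noncomputable def primitiveIdempotent {K 𝒜 : Type*} [Field K] [Ring 𝒜] [Algebra K 𝒜] {d : ℕ}
    (A : 𝒜) (θ : Fin (d + 1) → K) (i : Fin (d + 1)) : 𝒜 :=
  Polynomial.aeval A (Lagrange.basis Finset.univ θ i)

/-- The data `(A; {E_i}; A*; {E*_i})`, together with the sequences `{θ_i}` and `{θ*_i}`
(which `IsLeonardSystem` below ties to the rest). -/
structure LeonardData (K 𝒜 : Type*) (d : ℕ) where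
  A : 𝒜
  E : Fin (d + 1) → 𝒜
  Astar : 𝒜
  Estar : Fin (d + 1) → 𝒜
  θ : Fin (d + 1) → K
  θstar : Fin (d + 1) → K

namespace LeonardData

variable {K 𝒜 : Type*} [Field K] [Ring 𝒜] [Algebra K 𝒜] {d : ℕ}

/-- `Φ` is a Leonard system with eigenvalue sequence `θ` and dual eigenvalue sequence `θstar`.
To be used for a `K`-algebra isomorphic to the full matrix algebra of size `d + 1`; the spectrum of
an element is then the set of its eigenvalues in `K`. -/
structure IsLeonardSystem (Φ : LeonardData K 𝒜 d) : Prop where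
  /-- `A` is multiplicity-free, with eigenvalues `θ_0, …, θ_d` -/
  θ_injective : Function.Injective Φ.θ
  θ_mem : ∀ i, Φ.θ i ∈ spectrum K Φ.A
  /-- `A*` is multiplicity-free, with eigenvalues `θ*_0, …, θ*_d` -/
  θstar_injective : Function.Injective Φ.θstar
  θstar_mem : ∀ i, Φ.θstar i ∈ spectrum K Φ.Astar
  E_eq : ∀ i, Φ.E i = primitiveIdempotent Φ.A Φ.θ i
  Estar_eq : ∀ i, Φ.Estar i = primitiveIdempotent Φ.Astar Φ.θstar i
  E_Astar_E : ∀ i j : Fin (d + 1),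
    (((i : ℕ) + 1 < j ∨ (j : ℕ) + 1 < i) → Φ.E i * Φ.Astar * Φ.E j = 0) ∧
    (((i : ℕ) + 1 = j ∨ (j : ℕ) + 1 = i) → Φ.E i * Φ.Astar * Φ.E j ≠ 0)
  Estar_A_Estar : ∀ i j : Fin (d + 1),
    (((i : ℕ) + 1 < j ∨ (j : ℕ) + 1 < i) → Φ.Estar i * Φ.A * Φ.Estar j = 0) ∧
    (((i : ℕ) + 1 = j ∨ (j : ℕ) + 1 = i) → Φ.Estar i * Φ.A * Φ.Estar j ≠ 0)

/-- `Φ* = (A*; {E*_i}; A; {E_i})`. -/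
def dual (Φ : LeonardData K 𝒜 d) : LeonardData K 𝒜 d where
  A := Φ.Astar
  E := Φ.Estar
  Astar := Φ.A
  Estar := Φ.E
  θ := Φ.θstar
  θstar := Φ.θ

/-- `τ_i = (X - θ_0)(X - θ_1) ⋯ (X - θ_{i-1})`, for `0 ≤ i ≤ d`. -/
noncomputable def tau (Φ : LeonardData K 𝒜 d) (i : ℕ) : Polynomial K :=
  ∏ h ∈ Finset.univ.filter (fun h : Fin (d + 1) => (h : ℕ) < i),
    (Polynomial.X - Polynomial.C (Φ.θ h))

/-- `η_i = (X - θ_d)(X - θ_{d-1}) ⋯ (X - θ_{d-i+1})`, for `0 ≤ i ≤ d`. -/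
noncomputable def eta (Φ : LeonardData K 𝒜 d) (i : ℕ) : Polynomial K :=
  ∏ h ∈ Finset.univ.filter (fun h : Fin (d + 1) => d < (h : ℕ) + i),
    (Polynomial.X - Polynomial.C (Φ.θ h))

/-- The trace on `𝒜`, carried over from the matrix algebra. -/
noncomputable def tr (e : 𝒜 ≃ₐ[K] Matrix (Fin (d + 1)) (Fin (d + 1)) K) (X : 𝒜) : K :=
  (e X).trace

/-- First split sequence `{φ_i}_{i=1}^d`; the index `k : Fin d` stands for `i = k + 1`. -/
noncomputable def firstSplit (Φ : LeonardData K 𝒜 d)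
    (e : 𝒜 ≃ₐ[K] Matrix (Fin (d + 1)) (Fin (d + 1)) K) (k : Fin d) : K :=
  (Φ.θstar 0 - Φ.θstar k.succ) *
    (tr e (Polynomial.aeval Φ.A (Φ.tau (k + 1)) * Φ.Estar 0) /
      tr e (Polynomial.aeval Φ.A (Φ.tau k) * Φ.Estar 0))

/-- Second split sequence `{ϕ_i}_{i=1}^d`; the index `k : Fin d` stands for `i = k + 1`. -/
noncomputable def secondSplit (Φ : LeonardData K 𝒜 d)
    (e : 𝒜 ≃ₐ[K] Matrix (Fin (d + 1)) (Fin (d + 1)) K) (k : Fin d) : K :=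
  (Φ.θstar 0 - Φ.θstar k.succ) *
    (tr e (Polynomial.aeval Φ.A (Φ.eta (k + 1)) * Φ.Estar 0) /
      tr e (Polynomial.aeval Φ.A (Φ.eta k) * Φ.Estar 0))

end LeonardData

/-- For a sequence `x_1, …, x_d` (the index `k : Fin d` stands for `k + 1`), the product
`x_1 x_2 ⋯ x_r`, for `0 ≤ r ≤ d`. -/
def initialProd {K : Type*} [Field K] {d : ℕ} (x : Fin d → K) (r : ℕ) : K :=
  ∏ k ∈ Finset.univ.filter (fun k : Fin d => (k : ℕ) < r), x k

/-- For a sequence `x_1, …, x_d` (the index `k : Fin d` stands for `k + 1`), the product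
`x_d x_{d-1} ⋯ x_{d-r+1}`, for `0 ≤ r ≤ d`. -/
def finalProd {K : Type*} [Field K] {d : ℕ} (x : Fin d → K) (r : ℕ) : K :=
  ∏ k ∈ Finset.univ.filter (fun k : Fin d => d ≤ (k : ℕ) + r), x k

namespace LeonardData

variable {K 𝒜 : Type*} [Field K] [Ring 𝒜] [Algebra K 𝒜] {d : ℕ}

/-- The switching element
`S = ∑_r (ϕ_d ϕ_{d-1} ⋯ ϕ_{d-r+1}) / (φ_1 φ_2 ⋯ φ_r) E_r` of `Φ`. -/
noncomputable def switching (Φ : LeonardData K 𝒜 d)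
    (e : 𝒜 ≃ₐ[K] Matrix (Fin (d + 1)) (Fin (d + 1)) K) : 𝒜 :=
  ∑ r : Fin (d + 1),
    (finalProd (Φ.secondSplit e) r / initialProd (Φ.firstSplit e) r) • Φ.E r

/-- The dual switching element `S*` of `Φ`: the switching element of `Φ*`. -/
noncomputable def dualSwitching (Φ : LeonardData K 𝒜 d)
    (e : 𝒜 ≃ₐ[K] Matrix (Fin (d + 1)) (Fin (d + 1)) K) : 𝒜 :=
  Φ.dual.switching e

end LeonardData

/-- The matrix representing `X ∈ 𝒜` with respect to a basis `b` of the `𝒜`-module `V`: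
`X b_j = ∑_i Y_{ij} b_i`. -/
noncomputable def representingMatrix {K 𝒜 V : Type*} [Field K] [Ring 𝒜] [Algebra K 𝒜]
    [AddCommGroup V] [Module K V] [Module 𝒜 V] [IsScalarTower K 𝒜 V] {n : ℕ}
    (b : Module.Basis (Fin n) K V) (X : 𝒜) : Matrix (Fin n) (Fin n) K :=
  LinearMap.toMatrix b b (Algebra.lsmul K K V X)

/-! ### The scalars `[r, s, t]_q` -/

/-- `(q; q)_n = (1 - q)(1 - q²) ⋯ (1 - qⁿ)`. -/
def qPochhammer {L : Type*} [Field L] (q : L) (n : ℕ) : L :=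
  ∏ k ∈ Finset.range n, (1 - q ^ (k + 1))

open scoped Nat in
open Classical in
/-- The scalar `[r, s, t]_q`. For `q ≠ 1, -1` it is
`(q;q)_{r+s} (q;q)_{r+t} (q;q)_{s+t} / ((q;q)_r (q;q)_s (q;q)_t (q;q)_{r+s+t})`;
for `q = 1` and `q = -1` it is the limit of this expression.
In characteristic two, where `1 = -1`, the clause for `q = -1` applies. -/
noncomputable def bracket {L : Type*} [Field L] (q : L) (r s t : ℕ) : L :=
  if q = -1 then
    if Odd r ∧ Odd s ∧ Odd t then 0
    else
      ((((r + s) / 2)! : ℕ) * (((r + t) / 2)! : ℕ) * (((s + t) / 2)! : ℕ) : L) /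
        (((r / 2)! : ℕ) * ((s / 2)! : ℕ) * ((t / 2)! : ℕ) * (((r + s + t) / 2)! : ℕ))
  else if q = 1 then
    (((r + s)! : ℕ) * ((r + t)! : ℕ) * ((s + t)! : ℕ) : L) /
      ((r ! : ℕ) * (s ! : ℕ) * (t ! : ℕ) * ((r + s + t)! : ℕ))
  else
    (qPochhammer q (r + s) * qPochhammer q (r + t) * qPochhammer q (s + t)) /
      (qPochhammer q r * qPochhammer q s * qPochhammer q t * qPochhammer q (r + s + t))

/-- The nonzero scalar `q`, in some extension field `L` of `K`, is a base for the sequence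
`θ_0, …, θ_d`: if `d ≥ 3` then `q + q⁻¹ + 1` is the value at `i = 2` of
`(θ_{i-2} - θ_{i+1}) / (θ_{i-1} - θ_i)`. (For the eigenvalue sequence of a Leonard system this
value is the same for all `2 ≤ i ≤ d - 1`, and the same for the dual eigenvalue sequence; none of
that is assumed here.) If `d ≤ 2`, then `q` is arbitrary nonzero. -/
def IsBase {K L : Type*} [Field K] [Field L] [Algebra K L] {d : ℕ}
    (θ : Fin (d + 1) → K) (q : L) : Prop :=
  q ≠ 0 ∧ ∀ h : 3 ≤ d,
    q + q⁻¹ + 1 = algebraMap K L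
      ((θ ⟨0, by omega⟩ - θ ⟨3, by omega⟩) / (θ ⟨1, by omega⟩ - θ ⟨2, by omega⟩))

/-! ### Leonard pairs in matrix form -/

/-- The lower bidiagonal matrix with diagonal `θ_0, …, θ_d` and all subdiagonal entries `1`. -/
def lowerBidiagonal {K : Type*} [Field K] {d : ℕ} (θ : Fin (d + 1) → K) :
    Matrix (Fin (d + 1)) (Fin (d + 1)) K :=
  Matrix.of fun i j => if i = j then θ i else if (j : ℕ) + 1 = i then 1 else 0

/-- The upper bidiagonal matrix with diagonal `θ*_0, …, θ*_d` and superdiagonal `φ_1, …, φ_d`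
(the index `k : Fin d` stands for `k + 1`, so the entry in position `(k, k + 1)` is `φ k`). -/
def upperBidiagonal {K : Type*} [Field K] {d : ℕ} (θstar : Fin (d + 1) → K) (φ : Fin d → K) :
    Matrix (Fin (d + 1)) (Fin (d + 1)) K :=
  Matrix.of fun i j =>
    if i = j then θstar i
    else if h : (i : ℕ) + 1 = j then φ ⟨i, by have := j.isLt; omega⟩ else 0

/-- The sequence `(A; {E_i}; A*; {E*_i})` attached to the two bidiagonal matrices, where `E_i`
(resp. `E*_i`) is the primitive idempotent of `A` (resp. `A*`) for `θ_i` (resp. `θ*_i`). -/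
noncomputable def matrixData {K : Type*} [Field K] {d : ℕ} (θ θstar : Fin (d + 1) → K)
    (φ : Fin d → K) : LeonardData K (Matrix (Fin (d + 1)) (Fin (d + 1)) K) d where
  A := lowerBidiagonal θ
  E := primitiveIdempotent (lowerBidiagonal θ) θ
  Astar := upperBidiagonal θstar φ
  Estar := primitiveIdempotent (upperBidiagonal θstar φ) θstar
  θ := θ
  θstar := θstar

end Leonard

/-! Let `v` span `E*_0 V` and put `b_i = τ_i(A)v`, `c_i = η_i(A)v`. In each of these bases `A` is
lower bidiagonal with subdiagonal `1`, and `A*` is upper bidiagonal with diagonal `θ*_i`; the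
superdiagonals are the first and the second split sequence (`exists_splitBasis`, `split_ratio`).

The map `M : c_j ↦ (ϕ_1⋯ϕ_j / φ_1⋯φ_j) b_j` carries one bidiagonal form of `A*` to the other, so it
commutes with `A*`. As `A*` is multiplicity-free, `M` is a scalar on each `E*_r V`. Since `b_r` and
`c_r` have the same component in `E*_r V`, that scalar is `ϕ_1⋯ϕ_r / φ_1⋯φ_r`. This is also the
scalar by which `S*` acts there, because `Φ*` has first split sequence `φ_i` and second split
sequence `ϕ_{d-i+1}`. Hence `S* = M` (`switching_apply`), and `S*`, `S*⁻¹` are, up to diagonal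
factors, the transition matrices between the two bases.

These matrices are computed in `transition_entry`: `c_j = ∑_h [h, j-h, d-j]_q η_{j-h}(θ_0) b_h`, by
induction on `j` from `c_{j+1} = (A - θ_{d-j}) c_j`. Comparing coefficients reduces the induction to
one identity for the brackets (`bracket_step`), which uses closed forms for `θ_i` obtained from a
three-term recurrence. The recurrence is itself proved, from a commutator identity for `A` and `A*`
(`exists_commutator`, `exists_cubic`, `exists_recurrence`). Reversing the order of the `θ_i`
exchanges `b` and `c` and gives the inverse transition matrix.

In matrix form the standard basis is already `τ_i(A)e_0`. If only a Leonard pair is given, it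
remains to show that the listed eigenvalue orderings are the tridiagonal ones
(`IsTridiagonalIn.reindex`). -/

namespace Leonard

/-! ### The scalars `[r, s, t]_q` along a recurrent sequence -/

section Scalars

variable {L : Type*} [Field L]

/-- A common form of the bracket identity for all `q`: `F` is the factorial built from `g`, and `ε`
is the parity factor needed at `q = -1`. After cancelling the common factorials the claim is a
combination of `hgh`, which concerns `g` alone, and `ht`, which ties `g` to the sequence `t`. -/
theorem trinomial_step {d : ℕ} {t g F : ℕ → L} {h : ℕ → ℕ → L} {ε : ℕ → ℕ → ℕ → L}
    (hF0 : F 0 = 1) (hF : ∀ n, F (n + 1) = F n * g (n + 1))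
    (hg : ∀ n, n + 1 ≤ d → g (n + 1) ≠ 0)
    (hgh : ∀ r s u, g (r + s + 2) * g (u + 1) * ε (r + 1) (s + 1) u -
      g (s + u + 2) * g (r + 1) * ε r (s + 1) (u + 1) =
        h (r + 1) (u + 1) * g (s + 1) * ε (r + 1) s (u + 1))
    (ht : ∀ r u, r + u ≤ d → (t 0 - t (r + u)) * h r u = (t r - t u) * g (r + u))
    {r s u : ℕ} (hd : r + s + u + 2 = d) :
    (t 0 - t (r + u + 2)) *
        (ε (r + 1) (s + 1) u * ((F (r + 1 + (s + 1)) * F (r + 1 + u) * F (s + 1 + u)) /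
            (F (r + 1) * F (s + 1) * F u * F (r + 1 + (s + 1) + u))) -
          ε r (s + 1) (u + 1) * ((F (r + (s + 1)) * F (r + (u + 1)) * F (s + 1 + (u + 1))) /
            (F r * F (s + 1) * F (u + 1) * F (r + (s + 1) + (u + 1))))) =
      (t (r + 1) - t (u + 1)) *
        (ε (r + 1) s (u + 1) * ((F (r + 1 + s) * F (r + 1 + (u + 1)) * F (s + (u + 1))) /
            (F (r + 1) * F s * F (u + 1) * F (r + 1 + s + (u + 1))))) := by
  have hFne : ∀ n, n ≤ d → F n ≠ 0 := by
    intro n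
    induction n with
    | zero => intro _; rw [hF0]; exact one_ne_zero
    | succ n ih => intro hn; rw [hF]; exact mul_ne_zero (ih (by omega)) (hg n hn)
  have e1 : r + 1 + (s + 1) = r + s + 1 + 1 := by omega
  have e2 : r + 1 + u = r + u + 1 := by omega
  have e3 : s + 1 + u = s + u + 1 := by omega
  have e4 : r + s + 1 + 1 + u = d := by omega
  have e5 : r + (s + 1) = r + s + 1 := by omega
  have e6 : r + (u + 1) = r + u + 1 := by omega
  have e7 : s + 1 + (u + 1) = s + u + 1 + 1 := by omega
  have e8 : r + s + 1 + (u + 1) = d := by omega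
  have e9 : r + 1 + s = r + s + 1 := by omega
  have e10 : r + 1 + (u + 1) = r + u + 1 + 1 := by omega
  have e11 : s + (u + 1) = s + u + 1 := by omega
  have k1 := hgh r s u
  have k2 := ht (r + 1) (u + 1) (by omega)
  rw [e10] at k2
  rw [e1, e2, e3, e4, e5, e6, e7, e8, e9, e10, e11, e8, hF (r + s + 1), hF (s + u + 1),
    hF (r + u + 1), hF r, hF s, hF u]
  have n1 := hFne d le_rfl
  have n2 := hFne r (by omega)
  have n3 := hFne s (by omega)
  have n4 := hFne u (by omega)
  have g1 := hg r (by omega)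
  have g2 := hg s (by omega)
  have g3 := hg u (by omega)
  field_simp
  linear_combination F (r + s + 1) * F (r + u + 1) * F (s + u + 1) *
    ((t 0 - t (r + u + 2)) * k1 + ε (r + 1) s (u + 1) * g (s + 1) * k2)

theorem trinomial_zero_left {d : ℕ} {g F : ℕ → L} (hF0 : F 0 = 1)
    (hF : ∀ n, F (n + 1) = F n * g (n + 1)) (hg : ∀ n, n + 1 ≤ d → g (n + 1) ≠ 0)
    {s u : ℕ} (h : s + u ≤ d) :
    (F (0 + s) * F (0 + u) * F (s + u)) / (F 0 * F s * F u * F (0 + s + u)) = 1 ∧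
    (F (s + 0) * F (s + u) * F (0 + u)) / (F s * F 0 * F u * F (s + 0 + u)) = 1 := by
  have hFne : ∀ n, n ≤ d → F n ≠ 0 := by
    intro n
    induction n with
    | zero => intro _; rw [hF0]; exact one_ne_zero
    | succ n ih => intro hn; rw [hF]; exact mul_ne_zero (ih (by omega)) (hg n hn)
  have n1 := hFne s (by omega)
  have n2 := hFne u (by omega)
  have n3 := hFne (s + u) h
  simp only [Nat.zero_add, Nat.add_zero, hF0]
  constructor <;> field_simp

/-- The sequence `t_0, …, t_d` satisfies the three-term recurrence with base `q`. -/
def IsRecurrent (q : L) (d : ℕ) (t : ℕ → L) : Prop :=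
  ∀ i, i + 3 ≤ d → t i - t (i + 3) = (q + q⁻¹ + 1) * (t (i + 1) - t (i + 2))

/-- The characteristic roots of the recurrence are `1`, `q`, `q⁻¹`, and these are distinct here. At
`q = 1` they merge into a triple root (quadratic solutions when `2 ≠ 0`), at `q = -1` into `1, -1,
-1`. -/
theorem IsRecurrent.exists_geometric {q : L} (hq : q ≠ 0) (h1 : q ≠ 1) (h2 : q ≠ -1) {d : ℕ}
    {t : ℕ → L} (h : IsRecurrent q d t) :
    ∃ α β γ : L, ∀ i, i ≤ d → t i = α + β * q ^ i + γ * (q⁻¹) ^ i := by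
  have a1 : q - 1 ≠ 0 := sub_ne_zero.2 h1
  have a2 : q + 1 ≠ 0 := by rwa [← sub_neg_eq_add, sub_ne_zero]
  -- The coefficients solve the linear system that matches `t 0`, `t 1`, `t 2`; no recurrence is
  -- needed for these three values, so small `d` is covered.
  refine ⟨t 0 - (t 2 - t 1 - q⁻¹ * (t 1 - t 0)) / ((q - 1) * (q - q⁻¹))
      - (t 2 - t 1 - q * (t 1 - t 0)) / ((q⁻¹ - 1) * (q⁻¹ - q)),
      (t 2 - t 1 - q⁻¹ * (t 1 - t 0)) / ((q - 1) * (q - q⁻¹)),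
      (t 2 - t 1 - q * (t 1 - t 0)) / ((q⁻¹ - 1) * (q⁻¹ - q)), ?_⟩
  have a3 : q - q⁻¹ ≠ 0 := by
    have : q - q⁻¹ = (q - 1) * (q + 1) / q := by field_simp; ring
    rw [this]; positivity
  have a4 : q⁻¹ - 1 ≠ 0 := by
    have : q⁻¹ - 1 = - (q - 1) / q := by field_simp; ring
    rw [this]; exact div_ne_zero (neg_ne_zero.2 a1) hq
  have a5 : q⁻¹ - q ≠ 0 := by rw [← neg_sub]; exact neg_ne_zero.2 a3
  have hqq : q * q⁻¹ = 1 := mul_inv_cancel₀ hq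
  have b1 : (t 2 - t 1 - q⁻¹ * (t 1 - t 0)) / ((q - 1) * (q - q⁻¹)) * ((q - 1) * (q - q⁻¹))
    = (t 2 - t 1 - q⁻¹ * (t 1 - t 0)) := div_mul_cancel₀ _ (mul_ne_zero a1 a3)
  have b2 : (t 2 - t 1 - q * (t 1 - t 0)) / ((q⁻¹ - 1) * (q⁻¹ - q)) * ((q⁻¹ - 1) * (q⁻¹ - q))
    = (t 2 - t 1 - q * (t 1 - t 0)) := div_mul_cancel₀ _ (mul_ne_zero a4 a5)
  generalize (t 2 - t 1 - q⁻¹ * (t 1 - t 0)) / ((q - 1) * (q - q⁻¹)) = β at *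
  generalize (t 2 - t 1 - q * (t 1 - t 0)) / ((q⁻¹ - 1) * (q⁻¹ - q)) = γ at *
  generalize q⁻¹ = p at *
  have c1 : t 1 - t 0 = β * (q - 1) + γ * (p - 1) := by
    apply mul_left_cancel₀ a3
    linear_combination -b1 + b2
  have c2 : t 2 - t 1 = β * (q - 1) * q + γ * (p - 1) * p := by
    linear_combination p * c1 - b1
  have key : ∀ i, (i ≤ d → t i = t 0 - β - γ + β * q ^ i + γ * p ^ i) ∧
      (i + 1 ≤ d → t (i + 1) = t 0 - β - γ + β * q ^ (i + 1) + γ * p ^ (i + 1)) ∧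
      (i + 2 ≤ d → t (i + 2) = t 0 - β - γ + β * q ^ (i + 2) + γ * p ^ (i + 2)) := by
    intro i
    induction i with
    | zero =>
      refine ⟨fun _ => by ring, fun _ => by linear_combination c1, fun _ => by
        linear_combination c1 + c2⟩
    | succ i ih =>
      refine ⟨ih.2.1, ih.2.2, fun hi => ?_⟩
      have r := h i (by omega)
      have x0 := ih.1 (by omega)
      have x1 := ih.2.1 (by omega)
      have x2 := ih.2.2 (by omega)
      rw [x0, x1, x2] at r
      rw [show i + 1 + 2 = i + 3 by omega]
      have : p = q⁻¹ := eq_inv_of_mul_eq_one_right hqq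
      rw [← this] at r
      linear_combination (-1) * r - (β * q ^ i * (1 - q) + γ * p ^ i * (1 - p)) * hqq
  exact fun i => (key i).1

theorem IsRecurrent.exists_quadratic (h2 : (2 : L) ≠ 0) {d : ℕ}
    {t : ℕ → L} (h : IsRecurrent 1 d t) :
    ∃ α β γ : L, ∀ i, i ≤ d → t i = α + β * i + γ * i ^ 2 := by
  obtain ⟨γ, hγ⟩ : ∃ γ, γ * 2 = t 2 - 2 * t 1 + t 0 := ⟨_, div_mul_cancel₀ _ h2⟩
  refine ⟨t 0, t 1 - t 0 - γ, γ, ?_⟩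
  have key : ∀ i : ℕ, (i ≤ d → t i = t 0 + (t 1 - t 0 - γ) * i + γ * i ^ 2) ∧
      (i + 1 ≤ d → t (i + 1) = t 0 + (t 1 - t 0 - γ) * (i + 1) + γ * (i + 1) ^ 2) ∧
      (i + 2 ≤ d → t (i + 2) = t 0 + (t 1 - t 0 - γ) * (i + 2) + γ * (i + 2) ^ 2) := by
    intro i
    induction i with
    | zero =>
      refine ⟨fun _ => by simp, fun _ => by push_cast; ring, fun _ => ?_⟩
      push_cast
      linear_combination - hγ
    | succ i ih =>
      push_cast
      refine ⟨ih.2.1, fun hi => ?_, fun hi => ?_⟩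
      · rw [show i + 1 + 1 = i + 2 by omega]
        linear_combination ih.2.2 hi
      · have r := h i (by omega)
        rw [show i + 1 + 2 = i + 3 by omega]
        rw [inv_one] at r
        linear_combination (-1) * r + ih.1 (by omega) - 3 * ih.2.1 (by omega) +
          3 * ih.2.2 (by omega)
  exact fun i => (key i).1

/-- Even-indexed and odd-indexed terms form arithmetic progressions with opposite differences. This
form needs no division by `2`, so it also serves characteristic two. -/
theorem IsRecurrent.exists_parity {d : ℕ} {t : ℕ → L} (h : IsRecurrent (-1) d t) :
    ∃ c : L, ∀ k : ℕ, (2 * k ≤ d → t (2 * k) = t 0 + k * c) ∧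
      (2 * k + 1 ≤ d → t (2 * k + 1) = t 1 - k * c) := by
  refine ⟨t 2 - t 0, ?_⟩
  have key : ∀ k : ℕ, (2 * k ≤ d → t (2 * k) = t 0 + k * (t 2 - t 0)) ∧
      (2 * k + 1 ≤ d → t (2 * k + 1) = t 1 - k * (t 2 - t 0)) ∧
      (2 * k + 2 ≤ d → t (2 * k + 2) = t 0 + (k + 1) * (t 2 - t 0)) := by
    intro k
    induction k with
    | zero => exact ⟨fun _ => by simp, fun _ => by simp, fun _ => by simp⟩
    | succ k ih =>
      push_cast
      have x : 2 * k + 3 ≤ d → t (2 * k + 3) = t 1 - (k + 1) * (t 2 - t 0) := fun hk => by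
        have r := h (2 * k) hk
        rw [inv_neg, inv_one] at r
        linear_combination (-1) * r + ih.1 (by omega) + ih.2.1 (by omega) - ih.2.2 (by omega)
      refine ⟨ih.2.2, x, fun hk => ?_⟩
      have r := h (2 * k + 1) hk
      rw [inv_neg, inv_one] at r
      rw [show 2 * (k + 1) + 2 = 2 * k + 1 + 3 by omega]
      linear_combination (-1) * r + ih.2.1 (by omega) + ih.2.2 (by omega) - x (by omega)
  exact fun k => ⟨(key k).1, (key k).2.1⟩


open scoped Nat in
theorem bracket_step_neg_one {d : ℕ} {t : ℕ → L}
    (hinj : ∀ i j, i ≤ d → j ≤ d → t i = t j → i = j) (h : IsRecurrent (-1 : L) d t) :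
    (∀ r s u, r + s + u + 2 = d → (t 0 - t (r + u + 2)) *
      (bracket (-1 : L) (r + 1) (s + 1) u - bracket (-1 : L) r (s + 1) (u + 1)) =
        (t (r + 1) - t (u + 1)) * bracket (-1 : L) (r + 1) s (u + 1)) ∧
    ∀ s u, s + u ≤ d → bracket (-1 : L) 0 s u = 1 ∧ bracket (-1 : L) s 0 u = 1 := by
  obtain ⟨c, hc⟩ := h.exists_parity
  -- Here `g (2a) = a` and `g (2a+1) = 1`, so that `F n = ⌊n/2⌋!`. The function `m` is the one
  -- forced by `(t_0 - t_{r+u}) m r u = (t_r - t_u) g (r+u)` when `t` has the parity form.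
  let F : ℕ → L := fun n => ((n / 2)! : ℕ)
  let g : ℕ → L := fun n => if Even n then ((n / 2 : ℕ) : L) else 1
  let e : ℕ → ℕ → ℕ → L := fun r s u => if Odd r ∧ Odd s ∧ Odd u then 0 else 1
  let m : ℕ → ℕ → L := fun r u =>
    if Even r then (if Even u then ((u / 2 : ℕ) : L) - (r / 2 : ℕ) else 1)
    else if Even u then -1 else ((r / 2 : ℕ) : L) - (u / 2 : ℕ)
  have hb : ∀ r s u, bracket (-1 : L) r s u = e r s u *
      ((F (r + s) * F (r + u) * F (s + u)) / (F r * F s * F u * F (r + s + u))) := by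
    intro r s u
    simp only [bracket, if_true, e, F]
    split_ifs <;> simp
  have hF0 : F 0 = 1 := by simp [F]
  have g0 : ∀ a, g (2 * a) = a := fun a => by simp [g]
  have g1 : ∀ a, g (2 * a + 1) = 1 := fun a => by simp [g]
  have g2' : ∀ a, g (2 * a + 1 + 1) = a + 1 := fun a => by
    rw [show 2 * a + 1 + 1 = 2 * (a + 1) by ring, g0]; push_cast; rfl
  have gee : ∀ a b, g (2 * a + 2 * b + 2) = a + b + 1 := fun a b => by
    rw [show 2 * a + 2 * b + 2 = 2 * (a + b + 1) by ring, g0]; push_cast; rfl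
  have geo : ∀ a b, g (2 * a + (2 * b + 1) + 2) = 1 := fun a b => by
    rw [show 2 * a + (2 * b + 1) + 2 = 2 * (a + b + 1) + 1 by ring, g1]
  have goe : ∀ a b, g (2 * a + 1 + 2 * b + 2) = 1 := fun a b => by
    rw [show 2 * a + 1 + 2 * b + 2 = 2 * (a + b + 1) + 1 by ring, g1]
  have goo : ∀ a b, g (2 * a + 1 + (2 * b + 1) + 2) = a + b + 2 := fun a b => by
    rw [show 2 * a + 1 + (2 * b + 1) + 2 = 2 * (a + b + 2) by ring, g0]; push_cast; rfl
  have ho : ∀ a, ¬ Odd (2 * a) := fun a => by simp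
  have moo : ∀ a b, m (2 * a + 1) (2 * b + 1) = a - b := fun a b => by
    simp [m, show (2 * a + 1) / 2 = a by omega, show (2 * b + 1) / 2 = b by omega]
  have meo : ∀ a b, m (2 * a + 1 + 1) (2 * b + 1) = 1 := fun a b => by
    simp [m, parity_simps]
  have moe : ∀ a b, m (2 * a + 1) (2 * b + 1 + 1) = -1 := fun a b => by
    simp [m, parity_simps]
  have mee : ∀ a b, m (2 * a + 1 + 1) (2 * b + 1 + 1) = b - a := fun a b => by
    simp [m, parity_simps, show (2 * a + 1 + 1) / 2 = a + 1 by omega,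
      show (2 * b + 1 + 1) / 2 = b + 1 by omega]
  have hF : ∀ n, F (n + 1) = F n * g (n + 1) := by
    intro n
    rcases Nat.even_or_odd' n with ⟨a, rfl | rfl⟩
    · rw [g1]
      simp only [F]
      rw [show (2 * a + 1) / 2 = 2 * a / 2 by omega, mul_one]
    · rw [show 2 * a + 1 + 1 = 2 * (a + 1) by ring, g0]
      simp only [F]
      rw [show 2 * (a + 1) / 2 = a + 1 by omega, show (2 * a + 1) / 2 = a by omega,
        Nat.factorial_succ]
      push_cast; ring
  have hg : ∀ n, n + 1 ≤ d → g (n + 1) ≠ 0 := by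
    intro n hn
    rcases Nat.even_or_odd' (n + 1) with ⟨a, h' | h'⟩
    · rw [h', g0]
      -- If `a` vanished in `L`, then `t_{2a} = t_0`, against distinctness.
      intro h0
      have := (hc a).1 (by omega)
      rw [h0, zero_mul, add_zero] at this
      have := hinj _ _ (by omega) (by omega) this
      omega
    · rw [h', g1]; exact one_ne_zero
  refine ⟨fun r s u hd => ?_, fun s u hd => ?_⟩
  · rw [hb, hb, hb]
    refine trinomial_step (h := m) hF0 hF hg ?_ ?_ hd
    · intro r s u
      rcases Nat.even_or_odd' r with ⟨a, rfl | rfl⟩ <;>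
      rcases Nat.even_or_odd' s with ⟨b, rfl | rfl⟩ <;>
      rcases Nat.even_or_odd' u with ⟨k, rfl | rfl⟩ <;>
      simp only [gee, geo, goe, goo, g1, g2', mee, meo, moe, moo] <;>
      simp [e, parity_simps, ho] <;> ring
    · intro r u hd
      rcases Nat.even_or_odd' r with ⟨a, rfl | rfl⟩ <;>
      rcases Nat.even_or_odd' u with ⟨b, rfl | rfl⟩
      · rw [← mul_add] at hd ⊢
        rw [g0, (hc _).1 hd, (hc a).1 (by omega), (hc b).1 (by omega)]
        simp [m]; ring
      · rw [show 2 * a + (2 * b + 1) = 2 * (a + b) + 1 by ring] at hd ⊢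
        rw [g1, (hc _).2 hd, (hc a).1 (by omega), (hc b).2 (by omega)]
        simp [m]; ring
      · rw [show 2 * a + 1 + 2 * b = 2 * (a + b) + 1 by ring] at hd ⊢
        rw [g1, (hc _).2 hd, (hc a).2 (by omega), (hc b).1 (by omega)]
        simp [m]; ring
      · rw [show 2 * a + 1 + (2 * b + 1) = 2 * (a + b + 1) by ring] at hd ⊢
        rw [g0, (hc _).1 hd, (hc a).2 (by omega), (hc b).2 (by omega), moo]
        push_cast; ring
  · rw [hb, hb]
    have := trinomial_zero_left hF0 hF hg hd
    rw [this.1, this.2]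
    simp [e]

open scoped Nat in
-- This is the recurrence satisfied by the coefficients in `transition_entry`. Distinctness of the
-- `t_i` keeps the denominators nonzero: if `g n = 0` for some `1 ≤ n ≤ d`, the closed form of `t`
-- would give `t_n = t_0`.
theorem bracket_step {q : L} (hq : q ≠ 0) {d : ℕ} {t : ℕ → L}
    (hinj : ∀ i j, i ≤ d → j ≤ d → t i = t j → i = j) (h : IsRecurrent q d t) :
    (∀ r s u, r + s + u + 2 = d → (t 0 - t (r + u + 2)) *
      (bracket q (r + 1) (s + 1) u - bracket q r (s + 1) (u + 1)) =
        (t (r + 1) - t (u + 1)) * bracket q (r + 1) s (u + 1)) ∧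
    ∀ s u, s + u ≤ d → bracket q 0 s u = 1 ∧ bracket q s 0 u = 1 := by
  by_cases hm : q = -1
  · subst hm
    exact bracket_step_neg_one hinj h
  -- Away from `q = -1` there is no parity factor: `g n` is `n` or `1 - q ^ n`, and `m r u` is `u -
  -- r` or `q ^ r - q ^ u`.
  suffices H : ∃ (g F : ℕ → L) (m : ℕ → ℕ → L), F 0 = 1 ∧ (∀ n, F (n + 1) = F n * g (n + 1)) ∧
      (∀ n, n + 1 ≤ d → g (n + 1) ≠ 0) ∧
      (∀ r s u, g (r + s + 2) * g (u + 1) - g (s + u + 2) * g (r + 1) =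
        m (r + 1) (u + 1) * g (s + 1)) ∧
      (∀ r u, r + u ≤ d → (t 0 - t (r + u)) * m r u = (t r - t u) * g (r + u)) ∧
      ∀ r s u, bracket q r s u =
        (F (r + s) * F (r + u) * F (s + u)) / (F r * F s * F u * F (r + s + u)) by
    obtain ⟨g, F, m, hF0, hF, hg, hgm, ht, hb⟩ := H
    refine ⟨fun r s u hd => ?_, fun s u hd => ?_⟩
    · rw [hb, hb, hb]
      have := trinomial_step (ε := fun _ _ _ => 1) hF0 hF hg (h := m) (t := t) (by simpa using hgm)
        ht hd
      simpa using this
    · rw [hb, hb]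
      exact trinomial_zero_left hF0 hF hg hd
  by_cases h1 : q = 1
  · subst h1
    have h2 : (2 : L) ≠ 0 := fun h2 => hm (by linear_combination h2)
    obtain ⟨α, β, γ, ht⟩ := h.exists_quadratic h2
    refine ⟨fun n => n, fun n => (n ! : ℕ), fun r u => u - r, by simp, fun n => ?_, fun n hn h0 => ?_,
      fun r s u => ?_, fun r u hd => ?_, fun r s u => ?_⟩
    · simp only [Nat.factorial_succ]; push_cast; ring
    · have h3 := ht (n + 1) hn
      rw [show ((n + 1 : ℕ) : L) = 0 from h0] at h3
      have := hinj (n + 1) 0 hn (by omega) (by rw [h3, ht 0 (by omega)]; simp)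
      omega
    · push_cast; ring
    · rw [ht 0 (by omega), ht _ hd, ht r (by omega), ht u (by omega)]
      push_cast; ring
    · rw [bracket, if_neg hm, if_pos rfl]
  · obtain ⟨α, β, γ, ht⟩ := h.exists_geometric hq h1 hm
    have hp : ∀ n, q ^ n * q⁻¹ ^ n = 1 := fun n => by
      rw [← mul_pow, mul_inv_cancel₀ hq, one_pow]
    refine ⟨fun n => 1 - q ^ n, qPochhammer q, fun r u => q ^ r - q ^ u, by simp [qPochhammer],
      fun n => by rw [qPochhammer, Finset.prod_range_succ]; rfl, fun n hn h0 => ?_,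
      fun r s u => ?_, fun r u hd => ?_, fun r s u => ?_⟩
    · have h3 := ht (n + 1) hn
      have h4 := hp (n + 1)
      rw [← sub_eq_zero.1 h0, one_mul] at h4
      rw [h4, ← sub_eq_zero.1 h0] at h3
      have := hinj (n + 1) 0 hn (by omega) (by rw [h3, ht 0 (by omega)]; simp)
      omega
    · ring
    · rw [ht 0 (by omega), ht _ hd, ht r (by omega), ht u (by omega), pow_add, pow_add]
      have x1 := hp r
      have x2 := hp u
      simp only [pow_zero]
      generalize q⁻¹ ^ r = R' at *
      generalize q⁻¹ ^ u = U' at *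
      linear_combination γ * ((q ^ u - U') * x1 + (R' - q ^ r) * x2)
    · rw [bracket, if_neg hm, if_neg h1]

end Scalars

/-! ### The polynomials `τ_i` and initial products -/

section Tau

variable {K : Type*} [Field K] {d : ℕ}

/-- `(X - θ_0) ⋯ (X - θ_{i-1})`. -/
noncomputable def tauPoly (θ : Fin (d + 1) → K) (i : ℕ) : Polynomial K :=
  ∏ h ∈ Finset.univ.filter (fun h : Fin (d + 1) => (h : ℕ) < i),
    (Polynomial.X - Polynomial.C (θ h))

theorem filter_val_lt_succ {n : ℕ} (k : Fin n) :
    Finset.univ.filter (fun h : Fin n => (h : ℕ) < (k : ℕ) + 1) =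
      insert k (Finset.univ.filter (fun h : Fin n => (h : ℕ) < (k : ℕ))) := by
  ext h
  simp only [Finset.mem_filter, Finset.mem_univ, true_and, Finset.mem_insert, Fin.ext_iff]
  omega

theorem tauPoly_zero (θ : Fin (d + 1) → K) : tauPoly θ 0 = 1 := by
  simp [tauPoly]

theorem tauPoly_succ (θ : Fin (d + 1) → K) (k : Fin (d + 1)) :
    tauPoly θ (k + 1) = (Polynomial.X - Polynomial.C (θ k)) * tauPoly θ k := by
  rw [tauPoly, filter_val_lt_succ, Finset.prod_insert (by simp)]
  rfl

theorem tauPoly_monic (θ : Fin (d + 1) → K) (i : ℕ) : (tauPoly θ i).Monic :=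
  Polynomial.monic_prod_of_monic _ _ fun _ _ => Polynomial.monic_X_sub_C _

theorem tauPoly_natDegree (θ : Fin (d + 1) → K) (i : Fin (d + 1)) :
    (tauPoly θ i).natDegree = i := by
  induction i using Fin.induction with
  | zero => simp [tauPoly_zero]
  | succ k ih =>
    rw [Fin.val_succ]
    have := tauPoly_succ θ k.castSucc
    rw [Fin.val_castSucc] at this ih
    rw [this, (Polynomial.monic_X_sub_C _).natDegree_mul (tauPoly_monic _ _), ih,
      Polynomial.natDegree_X_sub_C, add_comm]

theorem tauPoly_eval_eq_zero (θ : Fin (d + 1) → K) {i : ℕ} {k : Fin (d + 1)} (h : (k : ℕ) < i) :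
    (tauPoly θ i).eval (θ k) = 0 := by
  rw [tauPoly, Polynomial.eval_prod]
  exact Finset.prod_eq_zero (i := k) (by simpa using h) (by simp)

theorem tauPoly_eval_ne_zero {θ : Fin (d + 1) → K} (hθ : Function.Injective θ) {i : ℕ}
    {k : Fin (d + 1)} (h : i ≤ k) : (tauPoly θ i).eval (θ k) ≠ 0 := by
  rw [tauPoly, Polynomial.eval_prod]
  refine Finset.prod_ne_zero_iff.2 fun j hj => ?_
  simp only [Finset.mem_filter, Finset.mem_univ, true_and] at hj
  simp only [Polynomial.eval_sub, Polynomial.eval_X, Polynomial.eval_C, sub_ne_zero]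
  intro e
  have := hθ e
  subst this
  omega

theorem initialProd_zero (x : Fin d → K) : initialProd x 0 = 1 := by
  simp [initialProd]

theorem initialProd_succ (x : Fin d → K) (k : Fin d) :
    initialProd x (k + 1) = x k * initialProd x k := by
  rw [initialProd, filter_val_lt_succ, Finset.prod_insert (by simp)]
  rfl

theorem initialProd_ne_zero {x : Fin d → K} (hx : ∀ k, x k ≠ 0) (r : ℕ) : initialProd x r ≠ 0 :=
  Finset.prod_ne_zero_iff.2 fun k _ => hx k

theorem finalProd_rev (x : Fin d → K) (r : ℕ) :
    finalProd (fun k => x k.rev) r = initialProd x r := by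
  rw [finalProd, initialProd]
  refine Finset.prod_bij' (fun k _ => k.rev) (fun k _ => k.rev) ?_ ?_ ?_ ?_ ?_ <;>
    simp [Fin.val_rev] <;> intros <;> omega

end Tau

/-! ### Triangular families of vectors -/

section Triangular

variable {K V ι : Type*} [Field K] [AddCommGroup V] [Module K V] [LinearOrder ι] [Fintype ι]

/-- Two bases related by an invertible triangular matrix define the same flag; `P` marks the
coordinates beyond a step of the flag. The coefficients vanish one after another from the top index
down. -/
theorem coeff_eq_zero_of_triangular (u : Module.Basis ι K V) {b : ι → V}
    (h0 : ∀ i k, i < k → u.repr (b i) k = 0) (h1 : ∀ i, u.repr (b i) i ≠ 0) {c : ι → K}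
    {P : ι → Prop} (hP : ∀ i k, i ≤ k → P i → P k)
    (hc : ∀ k, P k → u.repr (∑ i, c i • b i) k = 0) (k : ι) (hk : P k) : c k = 0 := by
  induction k using WellFoundedGT.induction with
  | ind k ih =>
    have h := hc k hk
    rw [map_sum, Finset.sum_apply', Finset.sum_eq_single k] at h
    · simpa [h1 k] using h
    · intro j _ hj
      rcases lt_or_gt_of_ne hj with hj | hj
      · simp [h0 j k hj]
      · simp [ih j hj (hP _ _ hj.le hk)]
    · simp

theorem coeff_eq_zero_of_lowerTriangular (u : Module.Basis ι K V) {b : ι → V}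
    (h0 : ∀ i k, k < i → u.repr (b i) k = 0) (h1 : ∀ i, u.repr (b i) i ≠ 0) {c : ι → K}
    {P : ι → Prop} (hP : ∀ i k, k ≤ i → P i → P k)
    (hc : ∀ k, P k → u.repr (∑ i, c i • b i) k = 0) (k : ι) (hk : P k) : c k = 0 := by
  induction k using WellFoundedLT.induction with
  | ind k ih =>
    have h := hc k hk
    rw [map_sum, Finset.sum_apply', Finset.sum_eq_single k] at h
    · simpa [h1 k] using h
    · intro j _ hj
      rcases lt_or_gt_of_ne hj with hj | hj
      · simp [ih j hj (hP _ _ hj.le hk)]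
      · simp [h0 j k hj]
    · simp

theorem linearIndependent_of_triangular (u : Module.Basis ι K V) {b : ι → V}
    (h0 : ∀ i k, i < k → u.repr (b i) k = 0) (h1 : ∀ i, u.repr (b i) i ≠ 0) :
    LinearIndependent K b := by
  rw [Fintype.linearIndependent_iff]
  intro c hc k
  exact coeff_eq_zero_of_triangular u h0 h1 (P := fun _ => True) (fun _ _ _ _ => trivial)
    (fun k _ => by rw [hc]; simp) k trivial

end Triangular

/-! ### Eigenbases of the pair and the split basis -/

section Core

variable {K V : Type*} [Field K] [AddCommGroup V] [Module K V] {d : ℕ}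

/-- `A` is diagonal with entries `θ` in the basis `w`. -/
def IsEigenbasis (A : Module.End K V) (θ : Fin (d + 1) → K) (w : Module.Basis (Fin (d + 1)) K V) :
    Prop :=
  ∀ i, A (w i) = θ i • w i

namespace IsEigenbasis

variable {A : Module.End K V} {θ : Fin (d + 1) → K} {w : Module.Basis (Fin (d + 1)) K V}

theorem aeval_apply (h : IsEigenbasis A θ w) (p : Polynomial K) (i : Fin (d + 1)) :
    Polynomial.aeval A p (w i) = p.eval (θ i) • w i := by
  induction p using Polynomial.induction_on' with
  | add p q hp hq => simp [hp, hq, add_smul]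
  | monomial n a =>
    have : ∀ n : ℕ, (A ^ n) (w i) = θ i ^ n • w i := by
      intro n
      induction n with
      | zero => simp
      | succ n ih => rw [pow_succ', Module.End.mul_apply, ih, map_smul, h i, smul_smul, pow_succ]
    simp [Polynomial.aeval_monomial, this, smul_smul, mul_comm]

theorem repr_aeval (h : IsEigenbasis A θ w) (p : Polynomial K) (y : V) (i : Fin (d + 1)) :
    w.repr (Polynomial.aeval A p y) i = p.eval (θ i) * w.repr y i := by
  have : w.coord i ∘ₗ Polynomial.aeval A p = p.eval (θ i) • w.coord i := by
    refine w.ext fun j => ?_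
    simp only [LinearMap.comp_apply, h.aeval_apply, LinearMap.smul_apply, map_smul,
      Module.Basis.coord_apply, Module.Basis.repr_self, smul_eq_mul]
    rcases eq_or_ne j i with rfl | hij
    · rfl
    · simp [hij]
  exact LinearMap.congr_fun this y

theorem repr_apply (h : IsEigenbasis A θ w) (y : V) (i : Fin (d + 1)) :
    w.repr (A y) i = θ i * w.repr y i := by
  simpa using h.repr_aeval Polynomial.X y i

theorem rev (h : IsEigenbasis A θ w) :
    IsEigenbasis A (fun i => θ i.rev) (w.reindex Fin.revPerm) := by
  intro i
  simpa using h i.rev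

/-- The trace of `X E_0`. -/
theorem trace_mul_idempotent (h : IsEigenbasis A θ w) (hθ : Function.Injective θ)
    (X : Module.End K V) (i : Fin (d + 1)) :
    LinearMap.trace K V (X * primitiveIdempotent A θ i) = w.repr (X (w i)) i := by
  rw [LinearMap.trace_eq_matrix_trace K w, Matrix.trace, Finset.sum_eq_single i]
  · rw [Matrix.diag, LinearMap.toMatrix_apply, Module.End.mul_apply, primitiveIdempotent,
      h.aeval_apply, Lagrange.eval_basis_self hθ.injOn (Finset.mem_univ _), one_smul]
  · intro j _ hj
    rw [Matrix.diag, LinearMap.toMatrix_apply, Module.End.mul_apply, primitiveIdempotent,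
      h.aeval_apply, Lagrange.eval_basis_of_ne hj.symm (Finset.mem_univ _)]
    simp
  · simp

theorem idempotent_apply (h : IsEigenbasis A θ w) (hθ : Function.Injective θ)
    (i j : Fin (d + 1)) :
    primitiveIdempotent A θ i (w j) = if i = j then w j else 0 := by
  rw [primitiveIdempotent, h.aeval_apply]
  split_ifs with hij
  · rw [hij, Lagrange.eval_basis_self hθ.injOn (Finset.mem_univ _), one_smul]
  · rw [Lagrange.eval_basis_of_ne hij (Finset.mem_univ _), zero_smul]

end IsEigenbasis

/-- `B` is irreducible tridiagonal in the basis `w`. -/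
def IsTridiagonalIn (B : Module.End K V) (w : Module.Basis (Fin (d + 1)) K V) : Prop :=
  IsIrreducibleTridiagonal (LinearMap.toMatrix w w B)

theorem IsTridiagonalIn.repr_eq_zero {B : Module.End K V} {w : Module.Basis (Fin (d + 1)) K V}
    (h : IsTridiagonalIn B w) {i j : Fin (d + 1)} (hij : (i : ℕ) + 1 < j ∨ (j : ℕ) + 1 < i) :
    w.repr (B (w j)) i = 0 := by
  have := (h i j).1 hij
  rwa [LinearMap.toMatrix_apply] at this

theorem IsTridiagonalIn.repr_ne_zero {B : Module.End K V} {w : Module.Basis (Fin (d + 1)) K V}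
    (h : IsTridiagonalIn B w) {i j : Fin (d + 1)} (hij : (i : ℕ) + 1 = j ∨ (j : ℕ) + 1 = i) :
    w.repr (B (w j)) i ≠ 0 := by
  have := (h i j).2 hij
  rwa [LinearMap.toMatrix_apply] at this

theorem IsTridiagonalIn.rev {B : Module.End K V} {w : Module.Basis (Fin (d + 1)) K V}
    (h : IsTridiagonalIn B w) : IsTridiagonalIn B (w.reindex Fin.revPerm) := by
  intro i j
  have := h i.rev j.rev
  simp only [LinearMap.toMatrix_apply, Module.Basis.repr_reindex, Module.Basis.reindex_apply,
    Fin.revPerm_symm, Fin.revPerm_apply, Finsupp.mapDomain_equiv_apply, Fin.val_rev] at this ⊢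
  refine ⟨fun hij => this.1 ?_, fun hij => this.2 ?_⟩ <;> omega

theorem repr_apply_eq_sum (w : Module.Basis (Fin (d + 1)) K V) (B : Module.End K V) (y : V)
    (i : Fin (d + 1)) : w.repr (B y) i = ∑ j, w.repr y j * w.repr (B (w j)) i := by
  conv_lhs => rw [← w.sum_repr y, map_sum, map_sum, Finset.sum_apply']
  simp

/-- The pair `A, B` with an eigenbasis of each, in which the other is irreducible tridiagonal. -/
structure IsEigenbasisPair (A B : Module.End K V) (θ θs : Fin (d + 1) → K)
    (w ws : Module.Basis (Fin (d + 1)) K V) : Prop where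
  θ_injective : Function.Injective θ
  θs_injective : Function.Injective θs
  eigen : IsEigenbasis A θ w
  eigen_dual : IsEigenbasis B θs ws
  tridiagonal : IsTridiagonalIn B w
  tridiagonal_dual : IsTridiagonalIn A ws

/-- In the basis `b`, the map `A` is lower bidiagonal with diagonal `θ` and subdiagonal `x`, and
`B` is upper bidiagonal with diagonal `θs` and superdiagonal `φ`. -/
structure IsSplitBasis (A B : Module.End K V) (θ θs : Fin (d + 1) → K) (x φ : Fin d → K)
    (b : Module.Basis (Fin (d + 1)) K V) : Prop where
  A_castSucc : ∀ k : Fin d, A (b k.castSucc) = θ k.castSucc • b k.castSucc + x k • b k.succ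
  A_last : A (b (Fin.last d)) = θ (Fin.last d) • b (Fin.last d)
  B_zero : B (b 0) = θs 0 • b 0
  B_succ : ∀ k : Fin d, B (b k.succ) = θs k.succ • b k.succ + φ k • b k.castSucc

namespace IsEigenbasisPair

variable {A B : Module.End K V} {θ θs : Fin (d + 1) → K} {w ws : Module.Basis (Fin (d + 1)) K V}

theorem dual (h : IsEigenbasisPair A B θ θs w ws) : IsEigenbasisPair B A θs θ ws w :=
  ⟨h.2, h.1, h.4, h.3, h.6, h.5⟩

theorem rev (h : IsEigenbasisPair A B θ θs w ws) :
    IsEigenbasisPair A B (fun i => θ i.rev) θs (w.reindex Fin.revPerm) ws :=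
  ⟨h.1.comp Fin.rev_injective, h.2, h.3.rev, h.4, h.5.rev, h.6⟩

/-- Irreducible tridiagonality makes `A` raise the top index of a vector by exactly one. -/
theorem repr_pow (h : IsEigenbasisPair A B θ θs w ws) (i : ℕ) :
    (∀ k : Fin (d + 1), i < k → ws.repr ((A ^ i) (ws 0)) k = 0) ∧
    ∀ k : Fin (d + 1), i = k → ws.repr ((A ^ i) (ws 0)) k ≠ 0 := by
  induction i with
  | zero =>
    refine ⟨fun k hk => ?_, fun k hk => ?_⟩
    · have : (0 : Fin (d + 1)) ≠ k := fun e => by rw [← e] at hk; simp at hk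
      simp [this]
    · have : k = 0 := Fin.ext hk.symm
      simp [this]
  | succ i ih =>
    refine ⟨fun k hk => ?_, fun k hk => ?_⟩
    · rw [pow_succ', Module.End.mul_apply, repr_apply_eq_sum]
      refine Finset.sum_eq_zero fun j _ => ?_
      by_cases hj : i < j
      · rw [ih.1 j hj, zero_mul]
      · rw [h.tridiagonal_dual.repr_eq_zero (by omega), mul_zero]
    · rw [pow_succ', Module.End.mul_apply, repr_apply_eq_sum,
        Finset.sum_eq_single ⟨i, by omega⟩]
      · exact mul_ne_zero (ih.2 _ rfl) (h.tridiagonal_dual.repr_ne_zero (by simp; omega))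
      · intro j _ hj
        by_cases hj' : i < j
        · rw [ih.1 j hj', zero_mul]
        · have : (j : ℕ) ≠ i := fun e => hj (Fin.ext e)
          rw [h.tridiagonal_dual.repr_eq_zero (by omega), mul_zero]
      · simp

theorem repr_aeval_of_natDegree_lt (h : IsEigenbasisPair A B θ θs w ws) {p : Polynomial K}
    {k : Fin (d + 1)} (hp : p.natDegree < k) :
    ws.repr (Polynomial.aeval A p (ws 0)) k = 0 := by
  rw [Polynomial.aeval_eq_sum_range, LinearMap.sum_apply, map_sum, Finset.sum_apply']
  refine Finset.sum_eq_zero fun i hi => ?_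
  rw [Finset.mem_range] at hi
  simp [(h.repr_pow i).1 k (by omega)]

/-- The top component depends on the degree only. It is therefore shared by `τ_k(A)v` and `η_k(A)v`,
which later fixes the eigenvalues of the switching map. -/
theorem repr_aeval_of_monic (h : IsEigenbasisPair A B θ θs w ws) {p : Polynomial K}
    (hm : p.Monic) {k : Fin (d + 1)} (hp : p.natDegree = k) :
    ws.repr (Polynomial.aeval A p (ws 0)) k = ws.repr ((A ^ (k : ℕ)) (ws 0)) k := by
  rw [Polynomial.aeval_eq_sum_range, LinearMap.sum_apply, map_sum, Finset.sum_apply',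
    Finset.sum_range_succ, Finset.sum_eq_zero fun i hi => ?_, hm.coeff_natDegree, hp]
  · simp
  · rw [Finset.mem_range] at hi
    simp [(h.repr_pow i).1 k (by omega)]

theorem repr_tau_eq_zero (h : IsEigenbasisPair A B θ θs w ws) {i k : Fin (d + 1)} (hik : i < k) :
    ws.repr (Polynomial.aeval A (tauPoly θ i) (ws 0)) k = 0 :=
  h.repr_aeval_of_natDegree_lt (by rwa [tauPoly_natDegree])

theorem repr_tau_self (h : IsEigenbasisPair A B θ θs w ws) (i : Fin (d + 1)) :
    ws.repr (Polynomial.aeval A (tauPoly θ i) (ws 0)) i = ws.repr ((A ^ (i : ℕ)) (ws 0)) i :=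
  h.repr_aeval_of_monic (tauPoly_monic _ _) (tauPoly_natDegree _ _)

theorem repr_tau_self_ne_zero (h : IsEigenbasisPair A B θ θs w ws) (i : Fin (d + 1)) :
    ws.repr (Polynomial.aeval A (tauPoly θ i) (ws 0)) i ≠ 0 := by
  rw [h.repr_tau_self]
  exact (h.repr_pow i).2 i rfl

theorem exists_basis (h : IsEigenbasisPair A B θ θs w ws) :
    ∃ b : Module.Basis (Fin (d + 1)) K V,
      ∀ i, b i = Polynomial.aeval A (tauPoly θ i) (ws 0) := by
  have hli := linearIndependent_of_triangular ws (fun i k => h.repr_tau_eq_zero (i := i) (k := k))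
    h.repr_tau_self_ne_zero
  refine ⟨basisOfLinearIndependentOfCardEqFinrank hli
    (by rw [Module.finrank_eq_card_basis ws]), fun i => ?_⟩
  rw [coe_basisOfLinearIndependentOfCardEqFinrank]

/-- Polynomials in `A` act diagonally on `w`, so a coordinate missing from `ws 0` would be missing
from every vector `τ_i(A)(ws 0)`, and these form a basis. -/
theorem repr_start_ne_zero (h : IsEigenbasisPair A B θ θs w ws) (k : Fin (d + 1)) :
    w.repr (ws 0) k ≠ 0 := by
  obtain ⟨b, hb⟩ := h.exists_basis
  intro h0
  have : w.coord k = 0 := b.ext fun i => by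
    rw [hb, Module.Basis.coord_apply, h.eigen.repr_aeval, h0, mul_zero, LinearMap.zero_apply]
  have := LinearMap.congr_fun this (w k)
  simp at this

/-- The vector `b_i` lies in the span of `ws_0, …, ws_i` and in the span of `w_i, …, w_d`, so `b` is
adapted to both flags. The first shows that `B b_i - θs_i b_i` involves only `b_k` with `k < i`; the
second, as `B` lowers the `w`-index by at most one, only those with `k ≥ i - 1`. One term `φ
b_{i-1}` remains. -/
theorem exists_splitBasis (h : IsEigenbasisPair A B θ θs w ws) :
    ∃ (b : Module.Basis (Fin (d + 1)) K V) (φ : Fin d → K), (∀ k, φ k ≠ 0) ∧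
      (∀ i, b i = Polynomial.aeval A (tauPoly θ i) (ws 0)) ∧
      IsSplitBasis A B θ θs (fun _ => 1) φ b := by
  obtain ⟨b, hb⟩ := h.exists_basis
  have hA : ∀ k : Fin (d + 1), Polynomial.aeval A (tauPoly θ (k + 1)) (ws 0) =
      A (b k) - θ k • b k := by
    intro k
    rw [tauPoly_succ, map_mul, Module.End.mul_apply, hb k]
    simp
  have hup : ∀ i k, i < k → ws.repr (b i) k = 0 := fun i k hik => by
    rw [hb]; exact h.repr_tau_eq_zero hik
  have hup1 : ∀ i, ws.repr (b i) i ≠ 0 := fun i => by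
    rw [hb]; exact h.repr_tau_self_ne_zero i
  have hlow : ∀ i k, k < i → w.repr (b i) k = 0 := fun i k hik => by
    rw [hb, h.eigen.repr_aeval, tauPoly_eval_eq_zero _ hik, zero_mul]
  have hlow1 : ∀ i, w.repr (b i) i ≠ 0 := fun i => by
    rw [hb, h.eigen.repr_aeval]
    exact mul_ne_zero (tauPoly_eval_ne_zero h.θ_injective le_rfl) (h.repr_start_ne_zero i)
  have hBz : ∀ i k, i ≤ k → b.repr (B (b i) - θs i • b i) k = 0 := by
    intro i k hik
    refine coeff_eq_zero_of_triangular ws hup hup1 (P := fun k => i ≤ k)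
      (fun _ _ h1 h2 => h2.trans h1) (fun k hk => ?_) k hik
    rw [b.sum_repr, map_sub, map_smul, Finsupp.sub_apply, Finsupp.smul_apply,
      h.eigen_dual.repr_apply, smul_eq_mul, ← sub_mul]
    rcases eq_or_lt_of_le hk with rfl | hk
    · simp
    · rw [hup _ _ hk, mul_zero]
  have hBw : ∀ i k : Fin (d + 1), (k : ℕ) + 1 < i → w.repr (B (b i)) k = 0 := by
    intro i k hik
    rw [repr_apply_eq_sum]
    refine Finset.sum_eq_zero fun j _ => ?_
    by_cases hj : j < i
    · rw [hlow i j hj, zero_mul]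
    · rw [h.tridiagonal.repr_eq_zero (by omega), mul_zero]
  have hBz' : ∀ i k : Fin (d + 1), (k : ℕ) + 1 < i → b.repr (B (b i) - θs i • b i) k = 0 := by
    intro i k hik
    refine coeff_eq_zero_of_lowerTriangular w hlow hlow1 (P := fun k => (k : ℕ) + 1 < i)
      (fun j k h1 h2 => ?_) (fun k hk => ?_) k hik
    · rw [Fin.le_def] at h1
      omega
    · rw [b.sum_repr, map_sub, map_smul, Finsupp.sub_apply, Finsupp.smul_apply, hBw _ _ hk,
        hlow i k (by rw [Fin.lt_def]; omega)]
      simp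
  have hB : ∀ k : Fin d, B (b k.succ) = θs k.succ • b k.succ +
      b.repr (B (b k.succ) - θs k.succ • b k.succ) k.castSucc • b k.castSucc := by
    intro k
    rw [← sub_eq_iff_eq_add']
    conv_lhs => rw [← b.sum_repr (B (b k.succ) - θs k.succ • b k.succ)]
    rw [Finset.sum_eq_single k.castSucc]
    · intro j _ hj
      have hj' : (j : ℕ) ≠ k := fun e => hj (Fin.ext e)
      by_cases hjk : (j : ℕ) + 1 < k.succ
      · rw [hBz' _ _ hjk, zero_smul]
      · rw [hBz _ _ (by rw [Fin.le_def]; simp at hjk ⊢; omega), zero_smul]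
    · simp
  refine ⟨b, fun k => b.repr (B (b k.succ) - θs k.succ • b k.succ) k.castSucc, fun k h0 => ?_, hb,
    ⟨fun k => ?_, ?_, ?_, hB⟩⟩
  · have h1 := hB k
    beta_reduce at h0
    rw [h0, zero_smul, add_zero] at h1
    -- If `φ_k` were zero, `B b_{k+1}` would have no `w_k` component; but an off-diagonal entry of
    -- `B` produces one.
    have h2 : w.repr (B (b k.succ)) k.castSucc ≠ 0 := by
      rw [repr_apply_eq_sum, Finset.sum_eq_single k.succ]
      · exact mul_ne_zero (hlow1 _) (h.tridiagonal.repr_ne_zero (by simp))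
      · intro j _ hj
        have hj' : (j : ℕ) ≠ k + 1 := fun e => hj (Fin.ext e)
        by_cases hjk : j < k.succ
        · rw [hlow _ _ hjk, zero_mul]
        · rw [h.tridiagonal.repr_eq_zero, mul_zero]
          left
          rw [Fin.lt_def] at hjk
          simp at hjk ⊢
          omega
      · simp
    apply h2
    rw [h1, map_smul, Finsupp.smul_apply, hlow _ _ (Fin.castSucc_lt_succ), smul_zero]
  · have h1 := hA k.castSucc
    rw [one_smul, hb k.succ, Fin.val_succ]
    rw [Fin.val_castSucc] at h1
    rw [h1]
    abel
  · have h1 := hA (Fin.last d)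
    rw [← sub_eq_zero, ← h1]
    apply w.repr.injective
    ext k
    rw [h.eigen.repr_aeval, tauPoly_eval_eq_zero _ (by simpa using k.isLt)]
    simp
  · rw [← sub_eq_zero]
    apply b.repr.injective
    ext k
    rw [hBz 0 k (Fin.zero_le _)]
    simp

end IsEigenbasisPair
end Core

/-! ### Coordinates and split sequences in a split basis -/

section Split

variable {K V : Type*} [Field K] [AddCommGroup V] [Module K V] {d : ℕ}
variable {A B : Module.End K V} {θ θs : Fin (d + 1) → K} {x φ : Fin d → K}
  {b w ws : Module.Basis (Fin (d + 1)) K V}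

namespace IsSplitBasis

/-- Reading the basis backwards exchanges the roles of `A` and `B`, so each fact about one yields a
fact about the other. Subdiagonal and superdiagonal are exchanged too, which is why the subdiagonal
`x` is kept general. -/
theorem rev_swap (h : IsSplitBasis A B θ θs x φ b) :
    IsSplitBasis B A (fun i => θs i.rev) (fun i => θ i.rev) (fun k => φ k.rev) (fun k => x k.rev)
      (b.reindex Fin.revPerm) := by
  refine ⟨fun k => ?_, ?_, ?_, fun k => ?_⟩
  · simpa [Fin.rev_castSucc, Fin.rev_succ] using h.B_succ k.rev
  · simpa using h.B_zero
  · simpa using h.A_last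
  · simpa [Fin.rev_castSucc, Fin.rev_succ] using h.A_castSucc k.rev

theorem repr_A_zero (h : IsSplitBasis A B θ θs x φ b) (y : V) :
    b.repr (A y) 0 = θ 0 * b.repr y 0 := by
  have : b.coord 0 ∘ₗ A = θ 0 • b.coord 0 := by
    refine b.ext fun i => ?_
    induction i using Fin.lastCases with
    | last =>
      simp only [LinearMap.comp_apply, h.A_last, LinearMap.smul_apply, map_smul]
      simp only [Module.Basis.coord_apply, Module.Basis.repr_self, smul_eq_mul]
      by_cases h0 : Fin.last d = 0
      · rw [h0]
      · simp [h0]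
    | cast k =>
      simp only [LinearMap.comp_apply, h.A_castSucc, LinearMap.smul_apply, map_smul, map_add]
      simp only [Module.Basis.coord_apply, Module.Basis.repr_self, smul_eq_mul]
      by_cases h0 : k.castSucc = 0
      · rw [h0]; simp
      · simp [h0]
  exact LinearMap.congr_fun this y

theorem repr_A_succ (h : IsSplitBasis A B θ θs x φ b) (y : V) (k : Fin d) :
    b.repr (A y) k.succ = θ k.succ * b.repr y k.succ + x k * b.repr y k.castSucc := by
  have : b.coord k.succ ∘ₗ A = θ k.succ • b.coord k.succ + x k • b.coord k.castSucc := by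
    refine b.ext fun i => ?_
    induction i using Fin.lastCases with
    | last =>
      simp only [LinearMap.comp_apply, h.A_last, LinearMap.smul_apply, map_smul,
        LinearMap.add_apply]
      simp only [Module.Basis.coord_apply, Module.Basis.repr_self, smul_eq_mul]
      by_cases h0 : Fin.last d = k.succ
      · rw [h0]; simp [(Fin.castSucc_lt_succ (i := k)).ne']
      · simp [h0]
    | cast j =>
      simp only [LinearMap.comp_apply, h.A_castSucc, LinearMap.smul_apply, map_smul, map_add,
        LinearMap.add_apply]
      simp only [Module.Basis.coord_apply, Module.Basis.repr_self, smul_eq_mul,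
        Finsupp.single_apply, Fin.succ_inj, Fin.castSucc_inj]
      by_cases h0 : j.castSucc = k.succ
      · have : j ≠ k := fun e => by subst e; exact (Fin.castSucc_lt_succ (i := j)).ne h0
        rw [h0]
        simp [this]
      · by_cases h1 : j = k
        · subst h1; simp [(Fin.castSucc_lt_succ (i := j)).ne]
        · simp [h0, h1]
  exact LinearMap.congr_fun this y

theorem repr_B_castSucc (h : IsSplitBasis A B θ θs x φ b) (y : V) (k : Fin d) :
    b.repr (B y) k.castSucc = θs k.castSucc * b.repr y k.castSucc + φ k * b.repr y k.succ := by
  have := h.rev_swap.repr_A_succ y k.rev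
  simpa [Fin.rev_succ, Fin.rev_castSucc] using this

theorem repr_B_last (h : IsSplitBasis A B θ θs x φ b) (y : V) :
    b.repr (B y) (Fin.last d) = θs (Fin.last d) * b.repr y (Fin.last d) := by
  simpa using h.rev_swap.repr_A_zero y

theorem aeval_tau_zero (h : IsSplitBasis A B θ θs x φ b) (i : Fin (d + 1)) :
    Polynomial.aeval A (tauPoly θ i) (b 0) = initialProd x i • b i := by
  induction i using Fin.induction with
  | zero => simp [tauPoly_zero, initialProd_zero]
  | succ k ih =>
    rw [Fin.val_succ, initialProd_succ]
    have := tauPoly_succ θ k.castSucc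
    rw [Fin.val_castSucc] at this ih
    rw [this, map_mul, Module.End.mul_apply, ih, map_smul]
    simp [h.A_castSucc, smul_smul, mul_comm]

theorem repr_aeval_dual_tau (h : IsSplitBasis A B θ θs x φ b) (i : Fin (d + 1)) (y : V) :
    b.repr (Polynomial.aeval B (tauPoly θs i) y) 0 = initialProd φ i * b.repr y i := by
  induction i using Fin.induction generalizing y with
  | zero => simp [tauPoly_zero, initialProd_zero]
  | succ k ih =>
    rw [Fin.val_succ, initialProd_succ]
    have := tauPoly_succ θs k.castSucc
    rw [Fin.val_castSucc] at this ih
    rw [this, mul_comm, map_mul, Module.End.mul_apply, ih]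
    simp [h.repr_B_castSucc]
    ring

/-- The first split sequence read off a split basis. -/
theorem split_ratio (h : IsSplitBasis A B θ θs x φ b) (hx : ∀ k, x k ≠ 0) (hφ : ∀ k, φ k ≠ 0)
    (hθs : Function.Injective θs) (hw : IsEigenbasis B θs ws) (k : Fin d) :
    (θs 0 - θs k.succ) * (ws.repr (Polynomial.aeval A (tauPoly θ (k + 1)) (ws 0)) 0 /
      ws.repr (Polynomial.aeval A (tauPoly θ k) (ws 0)) 0) = x k * φ k := by
  have hb0 : ∀ i, i ≠ 0 → ws.repr (b 0) i = 0 := by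
    intro i hi
    have h1 := hw.repr_apply (b 0) i
    rw [h.B_zero, map_smul, Finsupp.smul_apply, smul_eq_mul] at h1
    have : (θs 0 - θs i) * ws.repr (b 0) i = 0 := by rw [sub_mul, h1, sub_self]
    exact (mul_eq_zero.1 this).resolve_left (sub_ne_zero.2 fun e => hi (hθs e).symm)
  have hb : b 0 = ws.repr (b 0) 0 • ws 0 := by
    conv_lhs => rw [← ws.sum_repr (b 0)]
    rw [Finset.sum_eq_single 0]
    · intro i _ hi; rw [hb0 i hi, zero_smul]
    · simp
  have hγ : ws.repr (b 0) 0 ≠ 0 := fun h0 => b.ne_zero 0 (by rw [hb, h0, zero_smul])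
  have hT : ∀ i : Fin (d + 1), ws.repr (b 0) 0 *
      ws.repr (Polynomial.aeval A (tauPoly θ i) (ws 0)) 0 = initialProd x i * ws.repr (b i) 0 := by
    intro i
    have := h.aeval_tau_zero i
    rw [hb, map_smul] at this
    have := congrArg (fun y => ws.repr y 0) this
    simpa using this
  -- The coordinate along `ws 0` is a left eigenvector of `B` for `θs 0`; evaluated on `b_{k+1}`
  -- this relates its values on consecutive basis vectors.
  have hg : ∀ k : Fin d, (θs 0 - θs k.succ) * ws.repr (b k.succ) 0 =
      φ k * ws.repr (b k.castSucc) 0 := by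
    intro k
    have := hw.repr_apply (b k.succ) 0
    rw [h.B_succ] at this
    simp at this
    linear_combination -this
  have hne : ∀ k : Fin d, θs 0 - θs k.succ ≠ 0 := fun k =>
    sub_ne_zero.2 fun e => Fin.succ_ne_zero k (hθs e).symm
  have hgne : ∀ i, ws.repr (b i) 0 ≠ 0 := by
    intro i
    induction i using Fin.induction with
    | zero => exact hγ
    | succ k ih =>
      intro h0
      have := hg k
      rw [h0, mul_zero] at this
      exact mul_ne_zero (hφ k) ih this.symm
  have h1 := hT k.castSucc
  have h2 := hT k.succ
  rw [Fin.val_castSucc] at h1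
  rw [Fin.val_succ, initialProd_succ] at h2
  have hPx := initialProd_ne_zero hx k
  have hTk : ws.repr (Polynomial.aeval A (tauPoly θ k) (ws 0)) 0 ≠ 0 := fun h0 => by
    rw [h0, mul_zero] at h1
    exact mul_ne_zero hPx (hgne _) h1.symm
  rw [← mul_div_assoc, div_eq_iff hTk]
  apply mul_left_cancel₀ hγ
  linear_combination (θs 0 - θs k.succ) * h2 + x k * initialProd x k * hg k - x k * φ k * h1

/-- The first split sequence of the dual read off a split basis. -/
theorem dual_split_ratio (h : IsSplitBasis A B θ θs x φ b) (hx : ∀ k, x k ≠ 0)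
    (hφ : ∀ k, φ k ≠ 0) (hθ : Function.Injective θ) (hw : IsEigenbasis A θ w) (k : Fin d) :
    (θ 0 - θ k.succ) * (w.repr (Polynomial.aeval B (tauPoly θs (k + 1)) (w 0)) 0 /
      w.repr (Polynomial.aeval B (tauPoly θs k) (w 0)) 0) = x k * φ k := by
  have hf0 : ∀ i, i ≠ 0 → b.repr (w i) 0 = 0 := by
    intro i hi
    have h1 := h.repr_A_zero (w i)
    rw [hw i, map_smul, Finsupp.smul_apply, smul_eq_mul] at h1
    have : (θ i - θ 0) * b.repr (w i) 0 = 0 := by rw [sub_mul, h1, sub_self]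
    exact (mul_eq_zero.1 this).resolve_left (sub_ne_zero.2 fun e => hi (hθ e))
  -- Both functionals are left eigenvectors of `A` for `θ 0`, hence proportional.
  have hf : ∀ y, b.repr y 0 = b.repr (w 0) 0 * w.repr y 0 := by
    intro y
    conv_lhs => rw [← w.sum_repr y, map_sum, Finset.sum_apply']
    rw [Finset.sum_eq_single 0]
    · simp [mul_comm]
    · intro i _ hi; simp [hf0 i hi]
    · simp
  have hγ : b.repr (w 0) 0 ≠ 0 := fun h0 => by
    have := hf (b 0)
    rw [h0, zero_mul] at this
    simp at this
  have hT : ∀ i : Fin (d + 1), b.repr (w 0) 0 *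
      w.repr (Polynomial.aeval B (tauPoly θs i) (w 0)) 0 = initialProd φ i * b.repr (w 0) i := by
    intro i
    rw [← hf, h.repr_aeval_dual_tau]
  have hg : ∀ k : Fin d, (θ 0 - θ k.succ) * b.repr (w 0) k.succ = x k * b.repr (w 0) k.castSucc := by
    intro k
    have := h.repr_A_succ (w 0) k
    rw [hw 0] at this
    simp at this
    linear_combination this
  have hgne : ∀ i, b.repr (w 0) i ≠ 0 := by
    intro i
    induction i using Fin.induction with
    | zero => exact hγ
    | succ k ih =>
      intro h0
      have := hg k
      rw [h0, mul_zero] at this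
      exact mul_ne_zero (hx k) ih this.symm
  have h1 := hT k.castSucc
  have h2 := hT k.succ
  rw [Fin.val_castSucc] at h1
  rw [Fin.val_succ, initialProd_succ] at h2
  have hPx := initialProd_ne_zero hφ k
  have hTk : w.repr (Polynomial.aeval B (tauPoly θs k) (w 0)) 0 ≠ 0 := fun h0 => by
    rw [h0, mul_zero] at h1
    exact mul_ne_zero hPx (hgne _) h1.symm
  rw [← mul_div_assoc, div_eq_iff hTk]
  apply mul_left_cancel₀ hγ
  linear_combination (θ 0 - θ k.succ) * h2 + φ k * initialProd φ k * hg k - x k * φ k * h1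

end IsSplitBasis

/-! ### The recurrence for the eigenvalues -/

theorem exists_partial_sums (f : ℕ → K) : ∃ z : ℕ → K, ∀ n, z n - z (n + 1) = f n :=
  ⟨fun n => - ∑ i ∈ Finset.range n, f i, fun n => by
    simp only [Finset.sum_range_succ]; ring⟩

namespace IsEigenbasisPair

/-- In the eigenbasis of `A` the `(i, j)` entries of the two sides are `θ_i θ_j (θ_i - θ_j) B_ij`
and `(z_i - z_j) B_ij`. Only neighbouring `i, j` matter because `B` is tridiagonal, so `z` can be
chosen by partial summation. -/
theorem exists_commutator (h : IsEigenbasisPair A B θ θs w ws) :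
    ∃ z : Fin (d + 1) → K, (∀ k : Fin d, z k.castSucc - z k.succ =
        θ k.castSucc * θ k.succ * (θ k.castSucc - θ k.succ)) ∧
      ∀ p : Polynomial K, (∀ i, p.eval (θ i) = z i) →
        A * A * B * A - A * B * A * A =
          Polynomial.aeval A p * B - B * Polynomial.aeval A p := by
  obtain ⟨z, hz⟩ := exists_partial_sums (fun n => if hn : n < d then
    θ (Fin.castSucc ⟨n, hn⟩) * θ (Fin.succ ⟨n, hn⟩) *
      (θ (Fin.castSucc ⟨n, hn⟩) - θ (Fin.succ ⟨n, hn⟩)) else 0)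
  have hz' : ∀ k : Fin d, z (k.castSucc : Fin (d + 1)) - z (k.succ : Fin (d + 1)) =
      θ k.castSucc * θ k.succ * (θ k.castSucc - θ k.succ) := by
    intro k
    have := hz k
    rw [dif_pos k.isLt] at this
    simpa using this
  refine ⟨fun i => z i, hz', fun p hp => ?_⟩
  refine w.ext fun j => ?_
  apply w.repr.injective
  ext i
  simp only [LinearMap.sub_apply, Module.End.mul_apply, h.eigen j, map_smul, map_sub,
    Finsupp.sub_apply, Finsupp.smul_apply, h.eigen.repr_apply, h.eigen.repr_aeval,
    h.eigen.aeval_apply, hp, smul_eq_mul]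
  by_cases h1 : (i : ℕ) + 1 < j ∨ (j : ℕ) + 1 < i
  · rw [h.tridiagonal.repr_eq_zero h1]; ring
  · rcases lt_trichotomy i j with hij | rfl | hij
    · obtain ⟨k, rfl⟩ := Fin.exists_castSucc_eq.2 (show i ≠ Fin.last d from
        fun e => absurd (Fin.le_last j) (not_le.2 (e ▸ hij)))
      have hj : j = k.succ := by
        rw [Fin.lt_def] at hij; apply Fin.ext; simp at hij h1 ⊢; omega
      subst hj
      linear_combination -w.repr (B (w k.succ)) k.castSucc * hz' k
    · ring
    · obtain ⟨k, rfl⟩ := Fin.exists_castSucc_eq.2 (show j ≠ Fin.last d from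
        fun e => absurd (Fin.le_last i) (not_le.2 (e ▸ hij)))
      have hi : i = k.succ := by
        rw [Fin.lt_def] at hij; apply Fin.ext; simp at hij h1 ⊢; omega
      subst hi
      linear_combination w.repr (B (w k.castSucc)) k.succ * hz' k

end IsEigenbasisPair
end Split

section Recurrence

variable {K V : Type*} [Field K] [AddCommGroup V] [Module K V] {d : ℕ}
variable {A B : Module.End K V} {θ θs : Fin (d + 1) → K} {φ : Fin d → K}
  {b w ws : Module.Basis (Fin (d + 1)) K V}

theorem IsSplitBasis.repr_A_eq_zero {x : Fin d → K} (h : IsSplitBasis A B θ θs x φ b) {y : V}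
    {m : ℕ} (hy : ∀ k : Fin (d + 1), m < k → b.repr y k = 0) (k : Fin (d + 1)) (hk : m + 1 < k) :
    b.repr (A y) k = 0 := by
  induction k using Fin.cases with
  | zero => simp at hk
  | succ k =>
    rw [Fin.val_succ] at hk
    rw [h.repr_A_succ, hy k.succ (by rw [Fin.val_succ]; omega),
      hy k.castSucc (by rw [Fin.val_castSucc]; omega), mul_zero, mul_zero, add_zero]

theorem IsSplitBasis.repr_B_eq_zero {x : Fin d → K} (h : IsSplitBasis A B θ θs x φ b) {y : V}
    {m : ℕ} (hy : ∀ k : Fin (d + 1), m < k → b.repr y k = 0) (k : Fin (d + 1)) (hk : m < k) :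
    b.repr (B y) k = 0 := by
  induction k using Fin.lastCases with
  | last => rw [h.repr_B_last, hy _ hk, mul_zero]
  | cast k =>
    rw [Fin.val_castSucc] at hk
    rw [h.repr_B_castSucc, hy k.succ (by rw [Fin.val_succ]; omega),
      hy k.castSucc (by rw [Fin.val_castSucc]; omega), mul_zero, mul_zero, add_zero]

/-- Apply the commutator identity to `b_0`, an eigenvector of `B`. The left side contains three
factors `A` and so involves only `b_0, …, b_3`. Hence `y = p(A) b_0` satisfies `(θs 0 - B) y ∈
span(b_0, …, b_3)`, and triangularity of `B` with distinct diagonal entries puts `y` in that span.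
The coefficients of `y` give a polynomial of degree at most three with the values `z_i`. -/
theorem IsEigenbasisPair.exists_cubic (h : IsEigenbasisPair A B θ θs w ws) :
    ∃ P : Polynomial K, P.natDegree ≤ 3 ∧ ∀ k : Fin d,
      P.eval (θ k.castSucc) - P.eval (θ k.succ) =
        θ k.castSucc * θ k.succ * (θ k.castSucc - θ k.succ) := by
  obtain ⟨b, φ, -, hb, hsb⟩ := h.exists_splitBasis
  obtain ⟨z, hz, hcomm⟩ := h.exists_commutator
  obtain ⟨p, hp⟩ : ∃ p : Polynomial K, ∀ i, p.eval (θ i) = z i :=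
    ⟨Lagrange.interpolate Finset.univ θ z, fun i =>
      Lagrange.eval_interpolate_at_node z h.θ_injective.injOn (Finset.mem_univ i)⟩
  have hb0 : b 0 = ws 0 := by rw [hb]; simp [tauPoly_zero]
  have hc := LinearMap.congr_fun (hcomm p hp) (b 0)
  simp only [LinearMap.sub_apply, Module.End.mul_apply, hsb.B_zero, map_smul] at hc
  set y := Polynomial.aeval A p (b 0) with hy
  have v0 : ∀ k : Fin (d + 1), 0 < (k : ℕ) → b.repr (b 0) k = 0 := by
    intro k hk
    have : (0 : Fin (d + 1)) ≠ k := fun e => by rw [← e] at hk; simp at hk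
    simp [this]
  have v1 := hsb.repr_A_eq_zero v0
  have l1 := hsb.repr_A_eq_zero (hsb.repr_A_eq_zero (hsb.repr_B_eq_zero v1))
  have l2 := hsb.repr_A_eq_zero (hsb.repr_B_eq_zero (hsb.repr_A_eq_zero v1))
  have hk : ∀ k : Fin (d + 1), 3 < (k : ℕ) → θs 0 * b.repr y k = b.repr (B y) k := by
    intro k hk
    have := congrArg (fun y => b.repr y k) hc
    simp only [map_sub, map_smul, Finsupp.sub_apply, Finsupp.smul_apply, smul_eq_mul] at this
    rw [l1 k hk, l2 k hk] at this
    linear_combination -this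
  have hne : ∀ k : Fin (d + 1), 3 < (k : ℕ) → θs 0 - θs k ≠ 0 := by
    intro k hk
    refine sub_ne_zero.2 fun e => ?_
    have := h.θs_injective e
    rw [← this] at hk
    simp at hk
  have hzero : ∀ k : Fin (d + 1), 3 < (k : ℕ) → b.repr y k = 0 := by
    intro k
    induction k using Fin.reverseInduction with
    | last =>
      intro hd
      have := hk _ hd
      rw [hsb.repr_B_last] at this
      refine (mul_eq_zero.1 ?_).resolve_left (hne _ hd)
      linear_combination this
    | cast k ih =>
      intro hd
      have := hk _ hd
      rw [hsb.repr_B_castSucc, ih (by rw [Fin.val_castSucc] at hd; rw [Fin.val_succ]; omega)]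
        at this
      refine (mul_eq_zero.1 ?_).resolve_left (hne _ hd)
      linear_combination this
  let P : Polynomial K := ∑ m, Polynomial.C (b.repr y m) * tauPoly θ m
  have hP : ∀ i, P.eval (θ i) = z i := by
    intro i
    apply mul_right_cancel₀ (h.repr_start_ne_zero i)
    rw [← hp i, ← h.eigen.repr_aeval p, ← hb0, ← hy]
    conv_rhs => rw [← b.sum_repr y, map_sum, Finset.sum_apply']
    rw [Polynomial.eval_finsetSum, Finset.sum_mul]
    refine Finset.sum_congr rfl fun m _ => ?_
    rw [map_smul, Finsupp.smul_apply, hb m, h.eigen.repr_aeval, hb0]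
    simp [mul_assoc]
  refine ⟨P, ?_, fun k => by rw [hP, hP, hz]⟩
  refine Polynomial.natDegree_sum_le_of_forall_le _ _ fun m _ => ?_
  by_cases hm : 3 < (m : ℕ)
  · simp [hzero m hm]
  · refine (Polynomial.natDegree_C_mul_le _ _).trans ?_
    rw [tauPoly_natDegree]
    omega

/-- Take divided differences: dividing the cubic identity by `θ_i - θ_{i+1}` gives a symmetric
quadratic relation, and subtracting neighbours and dividing by `θ_i - θ_{i+2}` gives a linear one. A
last subtraction leaves the recurrence, with `a` the cubic coefficient. -/
theorem IsEigenbasisPair.exists_recurrence (h : IsEigenbasisPair A B θ θs w ws) :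
    ∃ a : K, ∀ (i : ℕ) (hi : i + 3 < d + 1),
      θ ⟨i + 1, by omega⟩ - θ ⟨i + 2, by omega⟩ = a * (θ ⟨i, by omega⟩ - θ ⟨i + 3, hi⟩) := by
  obtain ⟨P, hP, hz⟩ := h.exists_cubic
  have hev : ∀ y, P.eval y = P.coeff 0 + P.coeff 1 * y + P.coeff 2 * y ^ 2 + P.coeff 3 * y ^ 3 := by
    intro y
    rw [Polynomial.eval_eq_sum_range' (n := 4) (by omega)]
    simp [Finset.sum_range_succ]
  have hinj : ∀ (i j : ℕ) (hi : i < d + 1) (hj : j < d + 1), i ≠ j →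
      θ ⟨i, hi⟩ - θ ⟨j, hj⟩ ≠ 0 := fun i j hi hj hij =>
    sub_ne_zero.2 fun e => hij (by simpa using h.θ_injective e)
  have h2 : ∀ (i : ℕ) (hi : i + 1 < d + 1), θ ⟨i, by omega⟩ * θ ⟨i + 1, hi⟩ =
      P.coeff 1 + P.coeff 2 * (θ ⟨i, by omega⟩ + θ ⟨i + 1, hi⟩) +
        P.coeff 3 * (θ ⟨i, by omega⟩ ^ 2 + θ ⟨i, by omega⟩ * θ ⟨i + 1, hi⟩ + θ ⟨i + 1, hi⟩ ^ 2) := by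
    intro i hi
    have := hz ⟨i, by omega⟩
    rw [hev, hev] at this
    simp only [Fin.castSucc_mk, Fin.succ_mk] at this
    apply mul_right_cancel₀ (hinj i (i + 1) (by omega) hi (by omega))
    linear_combination -this
  have h3 : ∀ (i : ℕ) (hi : i + 2 < d + 1), θ ⟨i + 1, by omega⟩ =
      P.coeff 2 + P.coeff 3 * (θ ⟨i, by omega⟩ + θ ⟨i + 1, by omega⟩ + θ ⟨i + 2, hi⟩) := by
    intro i hi
    have e1 := h2 i (by omega)
    have e2 := h2 (i + 1) hi
    apply mul_right_cancel₀ (hinj i (i + 2) (by omega) hi (by omega))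
    linear_combination e1 - e2
  refine ⟨P.coeff 3, fun i hi => ?_⟩
  have e1 := h3 i (by omega)
  have e2 := h3 (i + 1) hi
  linear_combination e1 - e2

end Recurrence

/-! ### The transition matrix between the bases `τ_i(A)v` and `η_i(A)v` -/

section Transition

variable {K L V : Type*} [Field K] [Field L] [Algebra K L] [AddCommGroup V] [Module K V] {d : ℕ}
variable {A B : Module.End K V} {θ θs : Fin (d + 1) → K} {φ : Fin d → K}
  {b w ws : Module.Basis (Fin (d + 1)) K V} {q : L}

/-- A finite sequence in `K`, continued by zero and viewed in the extension field `L`. -/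
noncomputable def extendSeq (L : Type*) [Field L] [Algebra K L] (θ : Fin (d + 1) → K) (n : ℕ) : L :=
  if h : n < d + 1 then algebraMap K L (θ ⟨n, h⟩) else 0

theorem extendSeq_of_lt (θ : Fin (d + 1) → K) {n : ℕ} (h : n < d + 1) :
    extendSeq L θ n = algebraMap K L (θ ⟨n, h⟩) := dif_pos h

theorem extendSeq_injOn (hθ : Function.Injective θ) (i j : ℕ) (hi : i ≤ d) (hj : j ≤ d)
    (h : extendSeq L θ i = extendSeq L θ j) : i = j := by
  rw [extendSeq_of_lt θ (by omega), extendSeq_of_lt θ (by omega)] at h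
  simpa using hθ ((algebraMap K L).injective h)

/-- `IsBase` fixes only the first quotient; the constant `a`, the same for all indices and nonzero
since the `θ_i` are distinct, carries it to the others. -/
theorem IsEigenbasisPair.isRecurrent (h : IsEigenbasisPair A B θ θs w ws) (hq : IsBase θ q) :
    IsRecurrent q d (extendSeq L θ) := by
  intro i hi
  obtain ⟨a, ha⟩ := h.exists_recurrence
  have h0 := ha 0 (by omega)
  have hne : θ ⟨1, by omega⟩ - θ ⟨2, by omega⟩ ≠ 0 :=
    sub_ne_zero.2 fun e => by simpa using h.θ_injective e
  have ha0 : a ≠ 0 := fun e => hne (by simpa [e] using h0)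
  have hr : (θ ⟨0, by omega⟩ - θ ⟨3, by omega⟩) / (θ ⟨1, by omega⟩ - θ ⟨2, by omega⟩) = a⁻¹ := by
    rw [div_eq_iff hne, eq_inv_mul_iff_mul_eq₀ ha0]
    exact h0.symm
  rw [hq.2 (by omega), hr, extendSeq_of_lt θ (by omega), extendSeq_of_lt θ (by omega),
    extendSeq_of_lt θ (by omega), extendSeq_of_lt θ (by omega), ← map_sub, ← map_sub, ← map_mul,
    ha i (by omega), inv_mul_cancel_left₀ ha0]

theorem IsRecurrent.rev {t t' : ℕ → L} (h : IsRecurrent q d t) (ht : ∀ n, n ≤ d → t' n = t (d - n)) :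
    IsRecurrent q d t' := by
  intro i hi
  have := h (d - (i + 3)) (by omega)
  rw [ht i (by omega), ht (i + 1) (by omega), ht (i + 2) (by omega), ht (i + 3) hi]
  rw [show d - (i + 3) + 3 = d - i by omega, show d - (i + 3) + 1 = d - (i + 2) by omega,
    show d - (i + 3) + 2 = d - (i + 1) by omega] at this
  linear_combination -this

theorem extendSeq_rev (θ : Fin (d + 1) → K) (n : ℕ) (hn : n ≤ d) :
    extendSeq L (fun i => θ i.rev) n = extendSeq L θ (d - n) := by
  rw [extendSeq_of_lt _ (by omega), extendSeq_of_lt _ (by omega)]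
  congr 2
  apply Fin.ext
  simp [Fin.val_rev]

/-- Expands `η_j(A)v` in the vectors `τ_h(A)v`. In `c_{k+1} = (A - θ_{d-k}) c_k` the coefficient of
`b_{h+1}` comes from those of `b_{h+1}` and `b_h` in `c_k`. -/
theorem transition_entry {φ' : Fin d → K} {c : Module.Basis (Fin (d + 1)) K V}
    (hθ : Function.Injective θ) (hq : q ≠ 0) (hrec : IsRecurrent q d (extendSeq L θ))
    (hb : IsSplitBasis A B θ θs (fun _ => 1) φ b)
    (hc : IsSplitBasis A B (fun i => θ i.rev) θs (fun _ => 1) φ' c) (h0 : c 0 = b 0)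
    (j h : Fin (d + 1)) :
    algebraMap K L (b.repr (c j) h) = if h ≤ j then bracket q h (j - h : ℕ) (d - j : ℕ) *
      algebraMap K L ((tauPoly (fun i => θ i.rev) (j - h : ℕ)).eval (θ 0)) else 0 := by
  obtain ⟨hstep, hone⟩ := bracket_step hq (extendSeq_injOn (L := L) hθ) hrec
  induction j using Fin.induction generalizing h with
  | zero =>
    rw [h0]
    rcases eq_or_ne h 0 with rfl | hh
    · simp [tauPoly_zero, (hone 0 d (by omega)).1]
    · simp [hh]
  | succ k ih =>
    have hck : c k.succ = A (c k.castSucc) - θ k.castSucc.rev • c k.castSucc := by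
      rw [hc.A_castSucc]; simp
    have htau : ∀ (s : ℕ) (hs : s < d + 1) (y : K),
        (tauPoly (fun i => θ i.rev) (s + 1)).eval y =
          (y - θ (Fin.rev ⟨s, hs⟩)) * (tauPoly (fun i => θ i.rev) s).eval y := by
      intro s hs y
      have := tauPoly_succ (fun i => θ i.rev) ⟨s, hs⟩
      rw [this]; simp
    induction h using Fin.cases with
    | zero =>
      rw [if_pos (Fin.zero_le _), hck, map_sub, map_smul, Finsupp.sub_apply, hb.repr_A_zero,
        Finsupp.smul_apply, smul_eq_mul, ← sub_mul, map_mul, ih, if_pos (Fin.zero_le _)]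
      simp only [Fin.val_zero, Nat.sub_zero, Fin.val_succ, Fin.val_castSucc]
      rw [(hone _ _ (by omega)).1, (hone _ _ (by omega)).1, htau k (by omega), one_mul, one_mul,
        map_mul]
      rfl
    | succ h =>
      rw [hck, map_sub, map_smul, Finsupp.sub_apply, hb.repr_A_succ, Finsupp.smul_apply, smul_eq_mul,
        one_mul, map_sub, map_add, map_mul, map_mul, ih, ih]
      rcases lt_trichotomy h k with hk | rfl | hk
      · rw [if_pos (by rw [Fin.le_def]; simp; omega), if_pos (by rw [Fin.le_def]; simp; omega),
          if_pos (by rw [Fin.le_def]; simp; omega)]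
        simp only [Fin.val_succ, Fin.val_castSucc]
        rw [Fin.lt_def] at hk
        -- Strictly above the diagonal. With `d = h + s + u + 2` the new factor of `η_{s+1}(θ_0)` is
        -- `θ_0 - θ_{h+u+2}`; after removal of `η_s(θ_0)` the claim is `bracket_step`.
        obtain ⟨s, hs⟩ : ∃ s, (k : ℕ) = h + 1 + s := ⟨k - (h + 1), by omega⟩
        obtain ⟨u, hu⟩ : ∃ u, d = k + (u + 1) := ⟨d - (k + 1), by omega⟩
        have e1 : (k : ℕ) - (h + 1) = s := by omega
        have e2 : (k : ℕ) + 1 - (h + 1) = s + 1 := by omega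
        have e3 : (k : ℕ) - h = s + 1 := by omega
        have e4 : d - (k + 1) = u := by omega
        have e5 : d - k = u + 1 := by omega
        rw [e1, e2, e3, e4, e5, htau s (by omega)]
        have := hstep h s u (by omega)
        rw [extendSeq_of_lt θ (show 0 < d + 1 by omega),
          extendSeq_of_lt θ (show h + u + 2 < d + 1 by omega),
          extendSeq_of_lt θ (show (h : ℕ) + 1 < d + 1 by omega),
          extendSeq_of_lt θ (show u + 1 < d + 1 by omega)] at this
        have f1 : (Fin.rev ⟨s, by omega⟩ : Fin (d + 1)) = ⟨h + u + 2, by omega⟩ := by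
          apply Fin.ext; rw [Fin.val_rev]; simp; omega
        have f2 : (Fin.rev k.castSucc : Fin (d + 1)) = ⟨u + 1, by omega⟩ := by
          apply Fin.ext; rw [Fin.val_rev]; simp; omega
        have f3 : h.succ = ⟨(h : ℕ) + 1, by omega⟩ := rfl
        have f4 : (0 : Fin (d + 1)) = ⟨0, by omega⟩ := rfl
        rw [f1, f2, f3, f4]
        simp only [map_mul, map_sub]
        generalize algebraMap K L (Polynomial.eval _ _) = T
        linear_combination -T * this
      · rw [if_neg (by rw [Fin.le_def]; simp), if_pos (by rw [Fin.le_def]),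
          if_pos (by rw [Fin.le_def])]
        simp only [Fin.val_succ, Fin.val_castSucc, Nat.sub_self]
        rw [(hone _ _ (by omega)).2, (hone _ _ (by omega)).2]
        simp
      · rw [Fin.lt_def] at hk
        rw [if_neg (by rw [Fin.le_def]; simp; omega), if_neg (by rw [Fin.le_def]; simp; omega),
          if_neg (by rw [Fin.le_def]; simp; omega)]
        simp

/-- The map sending `ws_r` to `(ϕ_1 ⋯ ϕ_r / φ_1 ⋯ φ_r) ws_r` sends `η_j(A)v` to
`(ϕ_1 ⋯ ϕ_j / φ_1 ⋯ φ_j) τ_j(A)v`. -/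
theorem IsEigenbasisPair.switching_apply (h : IsEigenbasisPair A B θ θs w ws) {φ' : Fin d → K}
    {c : Module.Basis (Fin (d + 1)) K V} (hφ : ∀ k, φ k ≠ 0)
    (hb : IsSplitBasis A B θ θs (fun _ => 1) φ b)
    (hc : IsSplitBasis A B (fun i => θ i.rev) θs (fun _ => 1) φ' c)
    (hbt : ∀ i, b i = Polynomial.aeval A (tauPoly θ i) (ws 0))
    (hct : ∀ i, c i = Polynomial.aeval A (tauPoly (fun i => θ i.rev) i) (ws 0))
    {S : Module.End K V}
    (hS : ∀ r : Fin (d + 1), S (ws r) = (initialProd φ' r / initialProd φ r) • ws r)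
    (j : Fin (d + 1)) : S (c j) = (initialProd φ' j / initialProd φ j) • b j := by
  set M : Module.End K V :=
    c.constr K (fun j : Fin (d + 1) => (initialProd φ' j / initialProd φ j) • b j) with hM
  have hMc : ∀ j, M (c j) = (initialProd φ' j / initialProd φ j) • b j := fun j => by
    rw [hM, Module.Basis.constr_basis]
  -- The ratio of consecutive scalars is `ϕ_k / φ_k`, exactly the ratio of the superdiagonals of `B`
  -- in the two bases.
  have hcomm : M * B = B * M := by
    refine c.ext fun j => ?_
    rw [Module.End.mul_apply, Module.End.mul_apply, hMc]
    induction j using Fin.cases with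
    | zero => rw [hc.B_zero, map_smul, map_smul, hMc, hb.B_zero, smul_comm]
    | succ k =>
      rw [hc.B_succ, map_add, map_smul, map_smul, map_smul, hMc, hMc, hb.B_succ, smul_add, smul_smul,
        smul_smul, smul_smul, smul_smul, mul_comm]
      congr 2
      simp only [Fin.val_succ, Fin.val_castSucc, initialProd_succ]
      have := initialProd_ne_zero hφ k
      have := hφ k
      field_simp
  have hMw : ∀ i r, i ≠ r → ws.repr (M (ws i)) r = 0 := by
    intro i r hir
    have h1 := h.eigen_dual.repr_apply (M (ws i)) r
    rw [← Module.End.mul_apply, ← hcomm, Module.End.mul_apply, h.eigen_dual i, map_smul, map_smul,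
      Finsupp.smul_apply, smul_eq_mul] at h1
    have : (θs i - θs r) * ws.repr (M (ws i)) r = 0 := by rw [sub_mul, h1, sub_self]
    exact (mul_eq_zero.1 this).resolve_left (sub_ne_zero.2 fun e => hir (h.θs_injective e))
  have hMr : ∀ y r, ws.repr (M y) r = ws.repr y r * ws.repr (M (ws r)) r := by
    intro y r
    rw [repr_apply_eq_sum, Finset.sum_eq_single r]
    · intro i _ hi; rw [hMw i r hi, mul_zero]
    · simp
  -- Compare the `ws_r` coordinates of `M c_r` and `c_r`: those of `b_r` and `c_r` agree and are
  -- nonzero.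
  have hμ : ∀ r, ws.repr (M (ws r)) r = initialProd φ' r / initialProd φ r := by
    intro r
    have h1 := hMr (c r) r
    have h2 : ws.repr (c r) r = ws.repr (b r) r := by
      rw [hct, hbt, h.repr_tau_self, h.rev.repr_tau_self]
    have h3 : ws.repr (b r) r ≠ 0 := by rw [hbt]; exact h.repr_tau_self_ne_zero r
    rw [hMc, h2, map_smul, Finsupp.smul_apply, smul_eq_mul, mul_comm] at h1
    exact (mul_left_cancel₀ h3 h1).symm
  have hSM : S = M := by
    refine ws.ext fun r => ?_
    apply ws.repr.injective
    ext i
    rw [hS]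
    rcases eq_or_ne r i with rfl | hi
    · rw [hμ]; simp
    · rw [hMw r i hi]; simp [hi]
  rw [hSM, hMc]

end Transition

theorem LeonardData.tau_eq {K 𝒜 : Type*} [Field K] {d : ℕ} (Φ : LeonardData K 𝒜 d) (i : ℕ) : Φ.tau i = tauPoly Φ.θ i := rfl

theorem LeonardData.eta_eq {K 𝒜 : Type*} [Field K] {d : ℕ} (Φ : LeonardData K 𝒜 d) (i : ℕ) :
    Φ.eta i = tauPoly (fun i => Φ.θ i.rev) i := by
  rw [LeonardData.eta, tauPoly]
  refine Finset.prod_bij' (fun k _ => k.rev) (fun k _ => k.rev) ?_ ?_ ?_ ?_ ?_ <;>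
    simp [Fin.val_rev] <;> intros <;> omega

/-! ### From operators back to the Leonard data -/

section Realization

variable {K 𝒜 V : Type*} [Field K] [Ring 𝒜] [Algebra K 𝒜] [AddCommGroup V] [Module K V] {d : ℕ}

/-- A realization of Leonard data by linear maps of `V`, with an eigenbasis `w` of `A` and an
eigenbasis `ws` of `A*`. -/
structure Realizes (Φ : LeonardData K 𝒜 d) (e : 𝒜 ≃ₐ[K] Matrix (Fin (d + 1)) (Fin (d + 1)) K)
    (ρ : 𝒜 ≃ₐ[K] Module.End K V) (w ws : Module.Basis (Fin (d + 1)) K V) : Prop where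
  trace_eq : ∀ X, LinearMap.trace K V (ρ X) = LeonardData.tr e X
  pair : IsEigenbasisPair (ρ Φ.A) (ρ Φ.Astar) Φ.θ Φ.θstar w ws
  E_eq : ∀ i, Φ.E i = primitiveIdempotent Φ.A Φ.θ i
  Estar_eq : ∀ i, Φ.Estar i = primitiveIdempotent Φ.Astar Φ.θstar i

theorem map_primitiveIdempotent (ρ : 𝒜 ≃ₐ[K] Module.End K V) (A : 𝒜) (θ : Fin (d + 1) → K)
    (i : Fin (d + 1)) : ρ (primitiveIdempotent A θ i) = primitiveIdempotent (ρ A) θ i :=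
  (Polynomial.aeval_algHom_apply (ρ : 𝒜 →ₐ[K] Module.End K V) A _).symm

theorem map_aeval (ρ : 𝒜 ≃ₐ[K] Module.End K V) (A : 𝒜) (p : Polynomial K) :
    ρ (Polynomial.aeval A p) = Polynomial.aeval (ρ A) p :=
  (Polynomial.aeval_algHom_apply (ρ : 𝒜 →ₐ[K] Module.End K V) A p).symm

namespace Realizes

variable {Φ : LeonardData K 𝒜 d} {e : 𝒜 ≃ₐ[K] Matrix (Fin (d + 1)) (Fin (d + 1)) K}
  {ρ : 𝒜 ≃ₐ[K] Module.End K V} {w ws : Module.Basis (Fin (d + 1)) K V}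

theorem dual (R : Realizes Φ e ρ w ws) : Realizes Φ.dual e ρ ws w :=
  ⟨R.1, R.2.dual, R.4, R.3⟩

theorem tr_mul_Estar (R : Realizes Φ e ρ w ws) (p : Polynomial K) :
    LeonardData.tr e (Polynomial.aeval Φ.A p * Φ.Estar 0) =
      ws.repr (Polynomial.aeval (ρ Φ.A) p (ws 0)) 0 := by
  rw [← R.trace_eq, map_mul, R.Estar_eq, map_primitiveIdempotent, map_aeval,
    R.pair.eigen_dual.trace_mul_idempotent R.pair.θs_injective]

variable {φ φ' : Fin d → K} {b c : Module.Basis (Fin (d + 1)) K V}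

theorem firstSplit_eq (R : Realizes Φ e ρ w ws) (hφ : ∀ k, φ k ≠ 0)
    (hb : IsSplitBasis (ρ Φ.A) (ρ Φ.Astar) Φ.θ Φ.θstar (fun _ => 1) φ b) :
    Φ.firstSplit e = φ := by
  funext k
  rw [LeonardData.firstSplit, R.tr_mul_Estar, R.tr_mul_Estar, LeonardData.tau_eq,
    LeonardData.tau_eq, hb.split_ratio (fun _ => one_ne_zero) hφ R.pair.θs_injective
      R.pair.eigen_dual, one_mul]

theorem dual_firstSplit_eq (R : Realizes Φ e ρ w ws) (hφ : ∀ k, φ k ≠ 0)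
    (hb : IsSplitBasis (ρ Φ.A) (ρ Φ.Astar) Φ.θ Φ.θstar (fun _ => 1) φ b) :
    Φ.dual.firstSplit e = φ := by
  funext k
  rw [LeonardData.firstSplit, R.dual.tr_mul_Estar, R.dual.tr_mul_Estar, LeonardData.tau_eq,
    LeonardData.tau_eq]
  have := hb.dual_split_ratio (fun _ => one_ne_zero) hφ R.pair.θ_injective R.pair.eigen k
  rw [one_mul] at this
  exact this

theorem secondSplit_eq (R : Realizes Φ e ρ w ws) (hφ : ∀ k, φ' k ≠ 0)
    (hc : IsSplitBasis (ρ Φ.A) (ρ Φ.Astar) (fun i => Φ.θ i.rev) Φ.θstar (fun _ => 1) φ' c) :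
    Φ.secondSplit e = φ' := by
  funext k
  rw [LeonardData.secondSplit, R.tr_mul_Estar, R.tr_mul_Estar, LeonardData.eta_eq,
    LeonardData.eta_eq, hc.split_ratio (fun _ => one_ne_zero) hφ R.pair.θs_injective
      R.pair.eigen_dual, one_mul]

/-- `rev_swap` turns the basis `η_i(A)v` into a split basis for the dual data with reversed `θ_i`;
this reverses the sequence. -/
theorem dual_secondSplit_eq (R : Realizes Φ e ρ w ws) (hφ : ∀ k, φ' k ≠ 0)
    (hc : IsSplitBasis (ρ Φ.A) (ρ Φ.Astar) (fun i => Φ.θ i.rev) Φ.θstar (fun _ => 1) φ' c) :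
    Φ.dual.secondSplit e = fun k => φ' k.rev := by
  have hc' := hc.rev_swap
  simp only [Fin.rev_rev] at hc'
  funext k
  rw [LeonardData.secondSplit, R.dual.tr_mul_Estar, R.dual.tr_mul_Estar, LeonardData.eta_eq,
    LeonardData.eta_eq]
  have := hc'.split_ratio (fun k => hφ k.rev) (fun _ => one_ne_zero) R.pair.θ_injective
    R.pair.eigen k
  rw [mul_one] at this
  exact this

/-- The reversal in `dual_secondSplit_eq` turns the final products in the switching element into
initial ones. -/
theorem map_dualSwitching_apply (R : Realizes Φ e ρ w ws) (hφ : ∀ k, φ k ≠ 0)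
    (hφ' : ∀ k, φ' k ≠ 0)
    (hb : IsSplitBasis (ρ Φ.A) (ρ Φ.Astar) Φ.θ Φ.θstar (fun _ => 1) φ b)
    (hc : IsSplitBasis (ρ Φ.A) (ρ Φ.Astar) (fun i => Φ.θ i.rev) Φ.θstar (fun _ => 1) φ' c)
    (r : Fin (d + 1)) :
    ρ (Φ.dualSwitching e) (ws r) = (initialProd φ' r / initialProd φ r) • ws r := by
  rw [LeonardData.dualSwitching, LeonardData.switching, R.dual_firstSplit_eq hφ hb,
    R.dual_secondSplit_eq hφ' hc, map_sum, LinearMap.sum_apply, Finset.sum_eq_single r]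
  · rw [map_smul, LinearMap.smul_apply, finalProd_rev, R.dual.E_eq, map_primitiveIdempotent]
    erw [R.dual.pair.eigen.idempotent_apply R.dual.pair.θ_injective]
    rw [if_pos rfl]
  · intro i _ hi
    rw [map_smul, LinearMap.smul_apply, R.dual.E_eq, map_primitiveIdempotent]
    erw [R.dual.pair.eigen.idempotent_apply R.dual.pair.θ_injective]
    rw [if_neg hi, smul_zero]
  · simp

theorem isUnit_dualSwitching (R : Realizes Φ e ρ w ws) (hφ : ∀ k, φ k ≠ 0)
    (hφ' : ∀ k, φ' k ≠ 0)
    (hb : IsSplitBasis (ρ Φ.A) (ρ Φ.Astar) Φ.θ Φ.θstar (fun _ => 1) φ b)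
    (hc : IsSplitBasis (ρ Φ.A) (ρ Φ.Astar) (fun i => Φ.θ i.rev) Φ.θstar (fun _ => 1) φ' c) :
    IsUnit (Φ.dualSwitching e) := by
  have hS := R.map_dualSwitching_apply hφ hφ' hb hc
  have h1 : ∀ r, initialProd φ r ≠ 0 := initialProd_ne_zero hφ
  have h2 : ∀ r, initialProd φ' r ≠ 0 := initialProd_ne_zero hφ'
  let N : Module.End K V :=
    ws.constr K (fun r : Fin (d + 1) => (initialProd φ r / initialProd φ' r) • ws r)
  have hN : ∀ r, N (ws r) = (initialProd φ r / initialProd φ' r) • ws r := fun r => by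
    simp only [N, Module.Basis.constr_basis]
  have hu : IsUnit (ρ (Φ.dualSwitching e)) := by
    refine ⟨⟨ρ (Φ.dualSwitching e), N, ws.ext fun r => ?_, ws.ext fun r => ?_⟩, rfl⟩
    · have := h1 r
      have := h2 r
      rw [Module.End.mul_apply, hN, map_smul, hS, smul_smul, Module.End.one_apply]
      field_simp
      rw [one_smul]
    · have := h1 r
      have := h2 r
      rw [Module.End.mul_apply, hS, map_smul, hN, smul_smul, Module.End.one_apply]
      field_simp
      rw [one_smul]
  exact (MulEquiv.isUnit_map ρ).1 hu

theorem exists_split_basis_switching (R : Realizes Φ e ρ w ws) {L : Type*} [Field L] [Algebra K L]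
    {q : L} (hq : IsBase Φ.θ q) :
    ∃ b : Module.Basis (Fin (d + 1)) K V,
      (∀ i, b i = ρ (Polynomial.aeval Φ.A (Φ.tau i)) (ws 0)) ∧
      IsSplitBasis (ρ Φ.A) (ρ Φ.Astar) Φ.θ Φ.θstar (fun _ => 1) (Φ.firstSplit e) b ∧
      IsUnit (Φ.dualSwitching e) ∧
      (LinearMap.toMatrix b b (ρ (Φ.dualSwitching e))).BlockTriangular id ∧
      (LinearMap.toMatrix b b (ρ (Ring.inverse (Φ.dualSwitching e)))).BlockTriangular id ∧
      ∀ i j : Fin (d + 1), i ≤ j →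
        algebraMap K L (LinearMap.toMatrix b b (ρ (Φ.dualSwitching e)) i j) =
          bracket q i (j - i : ℕ) (d - j : ℕ) *
            algebraMap K L (initialProd (Φ.secondSplit e) i *
              (Φ.tau (j - i : ℕ)).eval (Φ.θ (Fin.last d)) / initialProd (Φ.firstSplit e) i) ∧
        algebraMap K L (LinearMap.toMatrix b b (ρ (Ring.inverse (Φ.dualSwitching e))) i j) =
          bracket q i (j - i : ℕ) (d - j : ℕ) *
            algebraMap K L (initialProd (Φ.firstSplit e) j *
              (Φ.eta (j - i : ℕ)).eval (Φ.θ 0) / initialProd (Φ.secondSplit e) j) := by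
  obtain ⟨b, φ, hφ, hbt, hb⟩ := R.pair.exists_splitBasis
  obtain ⟨c, φ', hφ', hct, hc⟩ := R.pair.rev.exists_splitBasis
  have hS := R.map_dualSwitching_apply hφ hφ' hb hc
  have hu := R.isUnit_dualSwitching hφ hφ' hb hc
  have hSc := R.pair.switching_apply hφ hb hc hbt hct hS
  have h1 : ∀ r, initialProd φ r ≠ 0 := initialProd_ne_zero hφ
  have h2 : ∀ r, initialProd φ' r ≠ 0 := initialProd_ne_zero hφ'
  have hTb : ∀ j : Fin (d + 1), ρ (Ring.inverse (Φ.dualSwitching e)) (b j) =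
      (initialProd φ j / initialProd φ' j) • c j := by
    intro j
    have h3 : ρ (Ring.inverse (Φ.dualSwitching e)) (ρ (Φ.dualSwitching e) (c j)) = c j := by
      rw [← Module.End.mul_apply, ← map_mul, Ring.inverse_mul_cancel _ hu, map_one,
        Module.End.one_apply]
    rw [hSc, map_smul] at h3
    rw [← h3, smul_smul]
    have := h1 j
    have := h2 j
    field_simp
    rw [one_smul]
  have hb0 : b 0 = ws 0 := by rw [hbt]; simp [tauPoly_zero]
  have hc0 : c 0 = ws 0 := by rw [hct]; simp [tauPoly_zero]
  have hrec := R.pair.isRecurrent hq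
  have hrec' : IsRecurrent q d (extendSeq L fun i => Φ.θ i.rev) := hrec.rev (extendSeq_rev _)
  have key := transition_entry (L := L) R.pair.θ_injective hq.1 hrec hb hc (hc0.trans hb0.symm)
  -- The same expansion for reversed eigenvalues, with `b` and `c` exchanged: now `τ` is evaluated
  -- at `θ_d`. The recurrence and `q` are unchanged by reversal.
  have key' := transition_entry (L := L) (θ := fun i => Φ.θ i.rev) (φ' := φ) (c := b)
    R.pair.rev.θ_injective hq.1 hrec' hc (by simpa only [Fin.rev_rev] using hb)
    (hb0.trans hc0.symm)
  -- `S*` is applied after expanding `b_j` in `c`, so its scalars carry the row index `i`; in `hTb`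
  -- the inverse scales `b_j` first, hence the column index `j`.
  have hSb : ∀ i j : Fin (d + 1), b.repr (ρ (Φ.dualSwitching e) (b j)) i =
      c.repr (b j) i * (initialProd φ' i / initialProd φ i) := by
    intro i j
    conv_lhs => rw [← c.sum_repr (b j), map_sum, map_sum, Finset.sum_apply']
    rw [Finset.sum_eq_single i]
    · rw [map_smul, hSc]; simp
    · intro k _ hk; rw [map_smul, hSc]; simp [hk]
    · simp
  refine ⟨b, fun i => by rw [hbt, map_aeval]; rfl, ?_, hu, ?_, ?_, fun i j hij => ⟨?_, ?_⟩⟩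
  · rwa [R.firstSplit_eq hφ hb]
  · intro i j hij
    apply (algebraMap K L).injective
    rw [LinearMap.toMatrix_apply, hSb, map_mul, key', if_neg (not_le.2 (show j < i from hij)), zero_mul, map_zero]
  · intro i j hij
    apply (algebraMap K L).injective
    rw [LinearMap.toMatrix_apply, hTb, map_smul, Finsupp.smul_apply, smul_eq_mul, map_mul, key,
      if_neg (not_le.2 (show j < i from hij)), mul_zero, map_zero]
  · rw [LinearMap.toMatrix_apply, hSb, map_mul, key', if_pos hij, R.firstSplit_eq hφ hb,
      R.secondSplit_eq hφ' hc, LeonardData.tau_eq, mul_assoc, ← map_mul]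
    simp only [Fin.rev_rev, Fin.rev_zero]
    congr 2
    ring
  · rw [LinearMap.toMatrix_apply, hTb, map_smul, Finsupp.smul_apply, smul_eq_mul, map_mul, key,
      if_pos hij, R.firstSplit_eq hφ hb, R.secondSplit_eq hφ' hc, LeonardData.eta_eq,
      mul_left_comm, ← map_mul]
    congr 2
    ring

end Realizes
end Realization

/-! ### Realizations of Leonard systems -/

section Systems

variable {K 𝒜 V : Type*} [Field K] [Ring 𝒜] [Algebra K 𝒜] [AddCommGroup V] [Module K V] {d : ℕ}

theorem exists_isEigenbasis [Module.Finite K V] (hV : Module.finrank K V = d + 1)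
    {A : Module.End K V} {θ : Fin (d + 1) → K} (hθ : Function.Injective θ)
    (h : ∀ i, A.HasEigenvalue (θ i)) :
    ∃ w : Module.Basis (Fin (d + 1)) K V, IsEigenbasis A θ w := by
  choose x hx using fun i => (h i).exists_hasEigenvector
  have hli := Module.End.eigenvectors_linearIndependent' A θ hθ x hx
  refine ⟨basisOfLinearIndependentOfCardEqFinrank hli (by simp [hV]), fun i => ?_⟩
  rw [coe_basisOfLinearIndependentOfCardEqFinrank]
  exact (hx i).apply_eq_smul

theorem IsEigenbasis.isTridiagonalIn {A B : Module.End K V} {θ : Fin (d + 1) → K}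
    {w : Module.Basis (Fin (d + 1)) K V} (hw : IsEigenbasis A θ w) (hθ : Function.Injective θ)
    (h : ∀ i j : Fin (d + 1),
      (((i : ℕ) + 1 < j ∨ (j : ℕ) + 1 < i) →
        primitiveIdempotent A θ i * B * primitiveIdempotent A θ j = 0) ∧
      (((i : ℕ) + 1 = j ∨ (j : ℕ) + 1 = i) →
        primitiveIdempotent A θ i * B * primitiveIdempotent A θ j ≠ 0)) :
    IsTridiagonalIn B w := by
  have hE : ∀ i y, primitiveIdempotent A θ i y = w.repr y i • w i := by
    intro i y
    conv_lhs => rw [← w.sum_repr y, map_sum]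
    rw [Finset.sum_eq_single i]
    · rw [map_smul, hw.idempotent_apply hθ, if_pos rfl]
    · intro j _ hj
      rw [map_smul, hw.idempotent_apply hθ, if_neg hj.symm, smul_zero]
    · simp
  intro i j
  rw [LinearMap.toMatrix_apply]
  refine ⟨fun hij => ?_, fun hij h0 => (h i j).2 hij (LinearMap.ext fun y => ?_)⟩
  · have := congrArg (fun f => w.repr (f (w j)) i) ((h i j).1 hij)
    simpa [Module.End.mul_apply, hE] using this
  · simp only [Module.End.mul_apply, hE, map_smul, h0]
    simp

theorem LeonardData.IsLeonardSystem.exists_realizes {Φ : LeonardData K 𝒜 d}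
    (h : Φ.IsLeonardSystem) {e : 𝒜 ≃ₐ[K] Matrix (Fin (d + 1)) (Fin (d + 1)) K}
    {ρ : 𝒜 ≃ₐ[K] Module.End K V} [Module.Finite K V] (hV : Module.finrank K V = d + 1)
    (htr : ∀ X, LinearMap.trace K V (ρ X) = LeonardData.tr e X) :
    ∃ w ws, Realizes Φ e ρ w ws := by
  obtain ⟨w, hw⟩ := exists_isEigenbasis hV h.θ_injective (A := ρ Φ.A) fun i => by
    rw [Module.End.hasEigenvalue_iff_mem_spectrum, AlgEquiv.spectrum_eq]
    exact h.θ_mem i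
  obtain ⟨ws, hws⟩ := exists_isEigenbasis hV h.θstar_injective (A := ρ Φ.Astar) fun i => by
    rw [Module.End.hasEigenvalue_iff_mem_spectrum, AlgEquiv.spectrum_eq]
    exact h.θstar_mem i
  refine ⟨w, ws, htr, ⟨h.θ_injective, h.θstar_injective, hw, hws,
    hw.isTridiagonalIn h.θ_injective fun i j => ?_,
    hws.isTridiagonalIn h.θstar_injective fun i j => ?_⟩, h.E_eq, h.Estar_eq⟩
  · have := h.E_Astar_E i j
    rw [h.E_eq, h.E_eq] at this
    rw [← map_primitiveIdempotent, ← map_primitiveIdempotent, ← map_mul, ← map_mul]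
    simpa only [ne_eq, EmbeddingLike.map_eq_zero_iff] using this
  · have := h.Estar_A_Estar i j
    rw [h.Estar_eq, h.Estar_eq] at this
    rw [← map_primitiveIdempotent, ← map_primitiveIdempotent, ← map_mul, ← map_mul]
    simpa only [ne_eq, EmbeddingLike.map_eq_zero_iff] using this

/-- The eigenspace of `A*` for `θ*_0` is a line, so `v` is a multiple of `ws 0`. Scaling all of `ws`
by the same constant leaves every matrix in that basis unchanged. -/
theorem Realizes.exists_start_eq {Φ : LeonardData K 𝒜 d}
    {e : 𝒜 ≃ₐ[K] Matrix (Fin (d + 1)) (Fin (d + 1)) K} {ρ : 𝒜 ≃ₐ[K] Module.End K V}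
    {w ws : Module.Basis (Fin (d + 1)) K V} (R : Realizes Φ e ρ w ws) {v : V} (hv : v ≠ 0)
    (hv0 : ρ Φ.Astar v = Φ.θstar 0 • v) : ∃ ws', ws' 0 = v ∧ Realizes Φ e ρ w ws' := by
  have h0 : ∀ i, i ≠ 0 → ws.repr v i = 0 := by
    intro i hi
    have h1 := R.pair.eigen_dual.repr_apply v i
    rw [hv0, map_smul, Finsupp.smul_apply, smul_eq_mul] at h1
    have : (Φ.θstar 0 - Φ.θstar i) * ws.repr v i = 0 := by rw [sub_mul, h1, sub_self]
    exact (mul_eq_zero.1 this).resolve_left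
      (sub_ne_zero.2 fun e => hi (R.pair.θs_injective e).symm)
  have hvw : v = ws.repr v 0 • ws 0 := by
    conv_lhs => rw [← ws.sum_repr v]
    rw [Finset.sum_eq_single 0]
    · intro i _ hi; rw [h0 i hi, zero_smul]
    · simp
  have hγ : ws.repr v 0 ≠ 0 := fun h => hv (by rw [hvw, h, zero_smul])
  refine ⟨ws.unitsSMul fun _ => Units.mk0 _ hγ, ?_, R.trace_eq, ⟨R.pair.θ_injective,
    R.pair.θs_injective, R.pair.eigen, fun i => ?_, R.pair.tridiagonal, fun i j => ?_⟩, R.E_eq,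
    R.Estar_eq⟩
  · rw [Module.Basis.unitsSMul_apply]
    exact hvw.symm
  · rw [Module.Basis.unitsSMul_apply, Units.smul_def, map_smul, R.pair.eigen_dual i, smul_comm]
  · have := R.pair.tridiagonal_dual i j
    rw [LinearMap.toMatrix_apply] at this ⊢
    rw [Module.Basis.unitsSMul_apply, Units.smul_def, map_smul, Module.Basis.repr_unitsSMul,
      map_smul, Finsupp.smul_apply, Units.smul_def, smul_smul, Units.val_inv_eq_inv_val,
      Units.val_mk0, inv_mul_cancel₀ hγ, one_smul]
    exact this

/-- Identifies `V` with the column module. The matrix units `f i i` sum to `1`, so some `f l l` does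
not kill `y`; the vectors `f i l • y` transform like columns and span a nonzero submodule, which is
all of `V` by simplicity. -/
theorem exists_basis_of_isSimpleModule (e : 𝒜 ≃ₐ[K] Matrix (Fin (d + 1)) (Fin (d + 1)) K)
    [Module 𝒜 V] [IsScalarTower K 𝒜 V] [IsSimpleModule 𝒜 V] :
    ∃ c : Module.Basis (Fin (d + 1)) K V, ∀ (X : 𝒜) (j : Fin (d + 1)),
      X • c j = ∑ i, e X i j • c i := by
  obtain ⟨y, hy⟩ : ∃ y : V, y ≠ 0 := by
    have := IsSimpleModule.nontrivial 𝒜 V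
    exact exists_ne 0
  let f : Fin (d + 1) → Fin (d + 1) → 𝒜 := fun i j => e.symm (Matrix.single i j 1)
  have hf : ∀ i j k l, f i j * f k l = if j = k then f i l else 0 := by
    intro i j k l
    simp only [f, ← map_mul]
    split_ifs with h
    · rw [h, Matrix.single_mul_single_same, one_mul]
    · rw [Matrix.single_mul_single_of_ne _ _ _ _ h, map_zero]
  have hX : ∀ X j l, X * f j l = ∑ i, e X i j • f i l := by
    intro X j l
    apply e.injective
    simp only [f, map_mul, map_sum, map_smul, AlgEquiv.apply_symm_apply]
    ext a b
    rw [Matrix.sum_apply]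
    by_cases hb : l = b
    · subst hb
      simp [Matrix.single_apply]
    · simp [hb, Matrix.mul_single_apply_of_ne _ _ _ _ _ (Ne.symm hb)]
  have h1 : ∑ i, f i i = 1 := by
    have : (∑ i, Matrix.single i i (1 : K) : Matrix (Fin (d + 1)) (Fin (d + 1)) K) = 1 := by
      ext a b
      rw [Matrix.sum_apply, Matrix.one_apply]
      by_cases hab : a = b
      · subst hab; simp [Matrix.single_apply]
      · rw [if_neg hab]
        refine Finset.sum_eq_zero fun i _ => ?_
        rw [Matrix.single_apply, if_neg]
        rintro ⟨rfl, rfl⟩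
        exact hab rfl
    rw [← map_sum, this, map_one]
  obtain ⟨l, hl⟩ : ∃ l, f l l • y ≠ 0 := by
    by_contra! h
    apply hy
    rw [← one_smul 𝒜 y, ← h1, Finset.sum_smul]
    exact Finset.sum_eq_zero fun i _ => h i
  let c : Fin (d + 1) → V := fun i => f i l • y
  have hXc : ∀ X j, X • c j = ∑ i, e X i j • c i := by
    intro X j
    simp only [c]
    rw [← mul_smul, hX, Finset.sum_smul]
    simp only [smul_assoc]
  have hli : LinearIndependent K c := by
    rw [Fintype.linearIndependent_iff]
    intro g hg k
    have := congrArg (fun v => f l k • v) hg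
    simp only [c, smul_zero, Finset.smul_sum] at this
    rw [Finset.sum_eq_single k] at this
    · rw [smul_comm, ← mul_smul, hf, if_pos rfl] at this
      exact (smul_eq_zero.1 this).resolve_right hl
    · intro j _ hj
      rw [smul_comm, ← mul_smul, hf, if_neg hj.symm, zero_smul, smul_zero]
    · simp
  let W : Submodule 𝒜 V :=
    { carrier := Submodule.span K (Set.range c)
      add_mem' := fun h h' => Submodule.add_mem _ h h'
      zero_mem' := Submodule.zero_mem _
      smul_mem' := fun X v hv => by
        refine Submodule.span_induction (p := fun v _ => X • v ∈ Submodule.span K (Set.range c))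
          ?_ ?_ ?_ ?_ hv
        · rintro _ ⟨j, rfl⟩
          rw [hXc]
          exact Submodule.sum_mem _ fun i _ =>
            Submodule.smul_mem _ _ (Submodule.subset_span ⟨i, rfl⟩)
        · rw [smul_zero]; exact Submodule.zero_mem _
        · intro a b _ _ ha hb; rw [smul_add]; exact Submodule.add_mem _ ha hb
        · intro a b _ hb; rw [smul_comm]; exact Submodule.smul_mem _ _ hb }
  have hW : W = ⊤ := by
    refine (eq_bot_or_eq_top W).resolve_left fun hbot => hl ?_
    have : c l ∈ W := Submodule.subset_span ⟨l, rfl⟩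
    rwa [hbot, Submodule.mem_bot] at this
  refine ⟨Module.Basis.mk hli fun v _ => ?_, fun X j => by simpa using hXc X j⟩
  have : v ∈ W := hW ▸ Submodule.mem_top
  exact this

end Systems

/-! ### Leonard pairs in bidiagonal form -/

section Bidiagonal

variable {K V : Type*} [Field K] [AddCommGroup V] [Module K V] {d : ℕ}
  {A B : Module.End K V} {θ θs : Fin (d + 1) → K} {x φ : Fin d → K}
  {b ws : Module.Basis (Fin (d + 1)) K V}

theorem IsSplitBasis.exists_eigenbasis_dual (h : IsSplitBasis A B θ θs x φ b)
    (hθs : Function.Injective θs) :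
    ∃ ws : Module.Basis (Fin (d + 1)) K V, IsEigenbasis B θs ws := by
  have := Module.Finite.of_basis b
  have htri : (LinearMap.toMatrix b b B).BlockTriangular id := by
    intro i j hij
    have hij : j < i := hij
    rw [LinearMap.toMatrix_apply]
    induction j using Fin.cases with
    | zero => rw [h.B_zero]; simp [hij.ne]
    | succ k =>
      rw [h.B_succ]
      simp [hij.ne, ((Fin.castSucc_lt_succ (i := k)).trans hij).ne]
  have hdiag : ∀ i, LinearMap.toMatrix b b B i i = θs i := by
    intro i
    rw [LinearMap.toMatrix_apply]
    induction i using Fin.cases with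
    | zero => rw [h.B_zero]; simp
    | succ k => rw [h.B_succ]; simp [(Fin.castSucc_lt_succ (i := k)).ne]
  refine exists_isEigenbasis (by rw [Module.finrank_eq_card_basis b, Fintype.card_fin]) hθs
    fun i => ?_
  rw [Module.End.hasEigenvalue_iff_isRoot_charpoly, ← LinearMap.charpoly_toMatrix B b,
    Matrix.charpoly_of_isUpperTriangular _ htri, Polynomial.IsRoot.def, Polynomial.eval_prod]
  exact Finset.prod_eq_zero (Finset.mem_univ i) (by simp [hdiag])

/-- Coordinates are determined from the last one down, since `B` is triangular with distinct
diagonal entries. The second alternative makes the whole eigenvector vanish, so it serves to prove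
that the diagonal coordinates are nonzero. -/
theorem IsSplitBasis.repr_eigenbasis_eq_zero (h : IsSplitBasis A B θ θs x φ b)
    (hθs : Function.Injective θs) (hw : IsEigenbasis B θs ws) (j k : Fin (d + 1))
    (hjk : j < k ∨ b.repr (ws j) j = 0) : b.repr (ws j) k = 0 := by
  induction k using Fin.reverseInduction with
  | last =>
    have := h.repr_B_last (ws j)
    rw [hw j, map_smul, Finsupp.smul_apply, smul_eq_mul] at this
    rcases eq_or_ne j (Fin.last d) with rfl | hj
    · simpa using hjk
    · refine (mul_eq_zero.1 ?_).resolve_left (sub_ne_zero.2 fun e => hj (hθs e))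
      linear_combination this
  | cast k ih =>
    have := h.repr_B_castSucc (ws j) k
    rw [hw j, map_smul, Finsupp.smul_apply, smul_eq_mul,
      ih (hjk.imp_left fun h => h.trans Fin.castSucc_lt_succ)] at this
    rcases eq_or_ne j k.castSucc with rfl | hj
    · simpa using hjk
    · refine (mul_eq_zero.1 ?_).resolve_left (sub_ne_zero.2 fun e => hj (hθs e))
      linear_combination this

/-- The bases `b` and `ws` define the same flag, and `A` moves that flag up by at most one step. -/
theorem IsSplitBasis.repr_A_eigenbasis (h : IsSplitBasis A B θ θs x φ b)
    (hθs : Function.Injective θs) (hw : IsEigenbasis B θs ws) {i j : Fin (d + 1)}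
    (hij : (j : ℕ) + 1 < i) : ws.repr (A (ws j)) i = 0 := by
  have h0 : ∀ j k, j < k → b.repr (ws j) k = 0 := fun j k hjk =>
    h.repr_eigenbasis_eq_zero hθs hw j k (Or.inl hjk)
  have h1 : ∀ j, b.repr (ws j) j ≠ 0 := fun j hj => ws.ne_zero j <| by
    apply b.repr.injective
    ext k
    rw [h.repr_eigenbasis_eq_zero hθs hw j k (Or.inr hj)]
    simp
  refine coeff_eq_zero_of_triangular b h0 h1 (P := fun k => (j : ℕ) + 1 < k)
    (fun a c hac ha => ?_) (fun k hk => ?_) i hij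
  · rw [Fin.le_def] at hac; omega
  · rw [ws.sum_repr]
    exact h.repr_A_eq_zero (fun k hk => h0 j k hk) k hk

/-- `B` is multiplicity-free, so any basis diagonalizing it agrees with `ws` up to order and
scalars. -/
theorem IsEigenbasis.exists_perm (hw : IsEigenbasis B θs ws) (hθs : Function.Injective θs)
    {v : Module.Basis (Fin (d + 1)) K V} {μ : Fin (d + 1) → K} (hv : ∀ i, B (v i) = μ i • v i) :
    ∃ σ : Equiv.Perm (Fin (d + 1)), IsEigenbasis B θs (v.reindex σ) := by
  have h1 : ∀ i, ∃ k, ws.repr (v i) k ≠ 0 := by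
    intro i
    by_contra! h
    apply v.ne_zero i
    apply ws.repr.injective
    ext k
    simp [h k]
  choose s hs using h1
  have hμ : ∀ i k, ws.repr (v i) k ≠ 0 → μ i = θs k := by
    intro i k hk
    have := hw.repr_apply (v i) k
    rw [hv i, map_smul, Finsupp.smul_apply, smul_eq_mul] at this
    exact mul_right_cancel₀ hk this
  have hvw : ∀ i, v i = ws.repr (v i) (s i) • ws (s i) := by
    intro i
    conv_lhs => rw [← ws.sum_repr (v i)]
    rw [Finset.sum_eq_single (s i)]
    · intro k _ hk
      by_cases h0 : ws.repr (v i) k = 0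
      · rw [h0, zero_smul]
      · exact absurd (hθs ((hμ i k h0).symm.trans (hμ i _ (hs i)))) hk
    · simp
  have hinj : Function.Injective s := by
    intro i j hij
    by_contra hne
    have h2 : ws.repr (v j) (s j) • v i = ws.repr (v i) (s i) • v j := by
      conv_lhs => rw [hvw i]
      conv_rhs => rw [hvw j]
      rw [hij, smul_comm]
    have := congrArg (fun y => v.repr y i) h2
    simp [Ne.symm hne] at this
    exact hs j this
  refine ⟨Equiv.ofBijective s (Finite.injective_iff_bijective.1 hinj), fun k => ?_⟩
  obtain ⟨i, rfl⟩ := (Finite.injective_iff_bijective.1 hinj).2 k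
  rw [Module.Basis.reindex_apply]
  have : (Equiv.ofBijective s (Finite.injective_iff_bijective.1 hinj)).symm (s i) = i :=
    Equiv.ofBijective_symm_apply_apply s _ i
  rw [this, hv, hμ i _ (hs i)]

/-- An injective walk with steps of length at most one moves at constant unit speed. -/
theorem abs_sub_of_unit_steps {f : ℕ → ℤ} {d : ℕ} (hinj : ∀ i j, i ≤ d → j ≤ d → f i = f j → i = j)
    (hstep : ∀ k, k < d → |f (k + 1) - f k| ≤ 1) {i j : ℕ} (hi : i ≤ d) (hj : j ≤ d) :
    |f i - f j| = |(i : ℤ) - j| := by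
  have hs : ∀ k, k < d → f (k + 1) - f k = 1 ∨ f (k + 1) - f k = -1 := by
    intro k hk
    have h1 := abs_le.1 (hstep k hk)
    have h2 : f (k + 1) ≠ f k := fun e => by have := hinj _ _ (by omega) (by omega) e; omega
    omega
  -- Injectivity forbids turning back, so all steps equal the first and `f` is affine.
  have hlin : ∀ k, k ≤ d → f k = f 0 + (f 1 - f 0) * k := by
    intro k
    induction k using Nat.strong_induction_on with
    | _ k ih =>
      intro hk
      match k with
      | 0 => simp
      | 1 => simp
      | k + 2 =>
        have e1 := ih k (by omega) (by omega)
        have e2 := ih (k + 1) (by omega) (by omega)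
        have h1 := hs k (by omega)
        have h2 := hs (k + 1) (by omega)
        have h3 : f (k + 1 + 1) ≠ f k := fun e => by
          have := hinj _ _ (by omega) (by omega) e; omega
        have e3 : f (k + 2) = 2 * f (k + 1) - f k := by
          rw [show k + 2 = k + 1 + 1 by omega]; omega
        rw [e3, e1, e2]
        push_cast; ring
  rw [hlin i hi, hlin j hj]
  rcases Nat.eq_zero_or_pos d with h0 | h0
  · have : i = j := by omega
    simp [this]
  · have h1 : |f 1 - f 0| = 1 := by rcases hs 0 h0 with h | h <;> simp at h <;> rw [h] <;> simp
    rw [show f 0 + (f 1 - f 0) * i - (f 0 + (f 1 - f 0) * j) = (f 1 - f 0) * (i - j) by ring,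
      abs_mul, h1, one_mul]

/-- The order in which `A` is tridiagonal may differ from the prescribed one by `σ`. Neighbours `i,
j` have nonzero entries both ways, and `h0` then gives `|σ i - σ j| ≤ 1`. Thus `σ` preserves
distances and does not affect the tridiagonal shape. -/
theorem IsTridiagonalIn.reindex {v : Module.Basis (Fin (d + 1)) K V} (h : IsTridiagonalIn A v)
    (σ : Equiv.Perm (Fin (d + 1)))
    (h0 : ∀ i j : Fin (d + 1), (j : ℕ) + 1 < i → (v.reindex σ).repr (A (v.reindex σ j)) i = 0) :
    IsTridiagonalIn A (v.reindex σ) := by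
  have h1 : ∀ i j : Fin (d + 1), v.repr (A (v j)) i ≠ 0 → (σ i : ℕ) ≤ σ j + 1 := by
    intro i j hij
    by_contra hlt
    have := h0 (σ i) (σ j) (by omega)
    simp at this
    exact hij this
  let f : ℕ → ℤ := fun n => if hn : n < d + 1 then (σ ⟨n, hn⟩ : ℕ) else 0
  have hf : ∀ i : Fin (d + 1), f i = (σ i : ℕ) := fun i => dif_pos i.isLt
  have habs : ∀ i j : Fin (d + 1), |((σ i : ℕ) : ℤ) - (σ j : ℕ)| = |((i : ℕ) : ℤ) - (j : ℕ)| := by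
    intro i j
    rw [← hf, ← hf]
    refine abs_sub_of_unit_steps (d := d) (fun i j hi hj hij => ?_) (fun k hk => ?_) (by omega)
      (by omega)
    · rw [hf ⟨i, by omega⟩, hf ⟨j, by omega⟩] at hij
      exact Fin.mk.inj (σ.injective (Fin.ext (by exact_mod_cast hij)))
    · have e1 := h1 ⟨k, by omega⟩ ⟨k + 1, by omega⟩ (h.repr_ne_zero (by simp))
      have e2 := h1 ⟨k + 1, by omega⟩ ⟨k, by omega⟩ (h.repr_ne_zero (by simp))
      rw [hf ⟨k, by omega⟩, hf ⟨k + 1, by omega⟩, abs_le]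
      omega
  intro i j
  have h2 := habs (σ.symm i) (σ.symm j)
  rw [Equiv.apply_symm_apply, Equiv.apply_symm_apply] at h2
  have h3 := h (σ.symm i) (σ.symm j)
  rw [LinearMap.toMatrix_apply] at h3 ⊢
  rw [Module.Basis.reindex_apply, Module.Basis.repr_reindex, Finsupp.mapDomain_equiv_apply]
  refine ⟨fun hij => h3.1 ?_, fun hij => h3.2 ?_⟩
  · rw [abs_eq_abs] at h2; omega
  · rw [abs_eq_abs] at h2; omega

theorem IsSplitBasis.exists_tridiagonal_eigenbasis (h : IsSplitBasis A B θ θs x φ b)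
    (hθs : Function.Injective θs) (hLP : ∃ (n : ℕ) (v : Module.Basis (Fin (n + 1)) K V),
      IsIrreducibleTridiagonal (LinearMap.toMatrix v v A) ∧ (LinearMap.toMatrix v v B).IsDiag) :
    ∃ ws : Module.Basis (Fin (d + 1)) K V, IsEigenbasis B θs ws ∧ IsTridiagonalIn A ws := by
  obtain ⟨n, v, hA, hB⟩ := hLP
  obtain rfl : n = d := by
    have h1 := Module.finrank_eq_card_basis v
    have h2 := Module.finrank_eq_card_basis b
    rw [Fintype.card_fin] at h1 h2
    omega
  have hv : ∀ i, B (v i) = LinearMap.toMatrix v v B i i • v i := by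
    intro i
    conv_lhs => rw [← v.sum_repr (B (v i))]
    rw [Finset.sum_eq_single i]
    · rw [LinearMap.toMatrix_apply]
    · intro j _ hj
      have : LinearMap.toMatrix v v B j i = 0 := hB hj
      rw [LinearMap.toMatrix_apply] at this
      rw [this, zero_smul]
    · simp
  obtain ⟨ws, hws⟩ := h.exists_eigenbasis_dual hθs
  obtain ⟨σ, hσ⟩ := hws.exists_perm hθs hv
  exact ⟨v.reindex σ, hσ, IsTridiagonalIn.reindex hA σ fun i j hij =>
    h.repr_A_eigenbasis hθs hσ hij⟩

theorem IsSplitBasis.exists_isEigenbasisPair (h : IsSplitBasis A B θ θs x φ b)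
    (hθ : Function.Injective θ) (hθs : Function.Injective θs) (hLP : IsLeonardPair A B) :
    ∃ w ws, IsEigenbasisPair A B θ θs w ws := by
  obtain ⟨ws, hws, hA⟩ := h.exists_tridiagonal_eigenbasis hθs hLP.1
  obtain ⟨w, hw, hB⟩ := h.rev_swap.exists_tridiagonal_eigenbasis (hθ.comp Fin.rev_injective) hLP.2
  exact ⟨w.reindex Fin.revPerm, ws, hθ, hθs, by simpa only [Fin.rev_rev] using hw.rev, hws, hB.rev,
    hA⟩

theorem isSplitBasis_bidiagonal (θ θs : Fin (d + 1) → K) (φ : Fin d → K) :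
    IsSplitBasis (Matrix.toLin' (lowerBidiagonal θ)) (Matrix.toLin' (upperBidiagonal θs φ)) θ θs
      (fun _ => 1) φ (Pi.basisFun K (Fin (d + 1))) := by
  have hs : ∀ k : Fin d, k.castSucc ≠ k.succ := fun k => (Fin.castSucc_lt_succ (i := k)).ne
  refine ⟨fun k => ?_, ?_, ?_, fun k => ?_⟩
  · ext i
    simp only [Pi.basisFun_apply, Matrix.toLin'_apply, Matrix.mulVec_single_one, Matrix.col_apply,
      lowerBidiagonal, Matrix.of_apply, Pi.add_apply, Pi.smul_apply, Pi.single_apply, smul_eq_mul]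
    by_cases h1 : i = k.castSucc
    · subst h1; simp [hs]
    · by_cases h2 : i = k.succ
      · subst h2; simp [(hs k).symm]
      · have : ¬ (k : ℕ) + 1 = i := fun e => h2 (Fin.ext (by simp [← e]))
        simp [h1, h2, this]
  · ext i
    simp only [Pi.basisFun_apply, Matrix.toLin'_apply, Matrix.mulVec_single_one, Matrix.col_apply,
      lowerBidiagonal, Matrix.of_apply, Pi.smul_apply, Pi.single_apply, smul_eq_mul]
    by_cases h1 : i = Fin.last d
    · subst h1; simp
    · have : ¬ d + 1 = (i : ℕ) := by omega
      simp [h1, this]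
  · ext i
    simp only [Pi.basisFun_apply, Matrix.toLin'_apply, Matrix.mulVec_single_one, Matrix.col_apply,
      upperBidiagonal, Matrix.of_apply, Pi.smul_apply, Pi.single_apply, smul_eq_mul]
    by_cases h1 : i = 0
    · subst h1; simp
    · simp [h1]
  · ext i
    simp only [Pi.basisFun_apply, Matrix.toLin'_apply, Matrix.mulVec_single_one, Matrix.col_apply,
      upperBidiagonal, Matrix.of_apply, Pi.add_apply, Pi.smul_apply, Pi.single_apply, smul_eq_mul]
    by_cases h1 : i = k.castSucc
    · subst h1; simp [hs]
    · by_cases h2 : i = k.succ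
      · subst h2; simp [(hs k).symm]
      · have : ¬ (i : ℕ) = k := fun e => h1 (Fin.ext (by simp [e]))
        simp [h1, h2, this]

end Bidiagonal

/-! ### Last links to the theorem -/

section Final

variable {K V : Type*} [Field K] [AddCommGroup V] [Module K V] {d : ℕ}

theorem isEigenvector_of_mem_Estar {𝒜 : Type*} [Ring 𝒜] [Algebra K 𝒜] {Φ : LeonardData K 𝒜 d}
    {e : 𝒜 ≃ₐ[K] Matrix (Fin (d + 1)) (Fin (d + 1)) K} {ρ : 𝒜 ≃ₐ[K] Module.End K V}
    {w ws : Module.Basis (Fin (d + 1)) K V} (R : Realizes Φ e ρ w ws) (u : V) :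
    ρ Φ.Astar (ρ (Φ.Estar 0) u) = Φ.θstar 0 • ρ (Φ.Estar 0) u := by
  apply ws.repr.injective
  ext i
  rw [R.pair.eigen_dual.repr_apply, map_smul, Finsupp.smul_apply, smul_eq_mul, R.Estar_eq,
    map_primitiveIdempotent, primitiveIdempotent, R.pair.eigen_dual.repr_aeval]
  rcases eq_or_ne i 0 with rfl | hi
  · rfl
  · rw [Lagrange.eval_basis_of_ne hi.symm (Finset.mem_univ _)]
    simp

theorem IsSplitBasis.eq_aeval_tau {A B : Module.End K V} {θ θs : Fin (d + 1) → K} {φ : Fin d → K}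
    {b : Module.Basis (Fin (d + 1)) K V} (h : IsSplitBasis A B θ θs (fun _ => 1) φ b)
    (i : Fin (d + 1)) : b i = Polynomial.aeval A (tauPoly θ i) (b 0) := by
  rw [h.aeval_tau_zero]
  simp [initialProd]

end Final
end Leonard

theorem theorem11p8 {K : Type*} [Field K] {L : Type*} [Field L] [Algebra K L] (d : ℕ) (q : L) :
    -- Leonard systems in an algebra isomorphic to the matrix algebra
    (∀ (𝒜 : Type*) [Ring 𝒜] [Algebra K 𝒜]
      (e : 𝒜 ≃ₐ[K] Matrix (Fin (d + 1)) (Fin (d + 1)) K)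
      (V : Type*) [AddCommGroup V] [Module K V] [Module 𝒜 V] [IsScalarTower K 𝒜 V]
      [IsSimpleModule 𝒜 V]
      (Φ : Leonard.LeonardData K 𝒜 d), Φ.IsLeonardSystem → Leonard.IsBase Φ.θ q →
      ∀ v : V, v ≠ 0 → (∃ u : V, v = Φ.Estar 0 • u) →
      ∃ b : Module.Basis (Fin (d + 1)) K V,
        (∀ i, b i = Polynomial.aeval Φ.A (Φ.tau i) • v) ∧
        IsUnit (Φ.dualSwitching e) ∧
        (Leonard.representingMatrix b (Φ.dualSwitching e)).BlockTriangular id ∧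
        (Leonard.representingMatrix b (Ring.inverse (Φ.dualSwitching e))).BlockTriangular id ∧
        ∀ i j : Fin (d + 1), i ≤ j →
          algebraMap K L (Leonard.representingMatrix b (Φ.dualSwitching e) i j) =
            Leonard.bracket q i (j - i : ℕ) (d - j : ℕ) *
              algebraMap K L
                (Leonard.initialProd (Φ.secondSplit e) i *
                    (Φ.tau (j - i : ℕ)).eval (Φ.θ (Fin.last d)) /
                  Leonard.initialProd (Φ.firstSplit e) i) ∧
          algebraMap K L
              (Leonard.representingMatrix b (Ring.inverse (Φ.dualSwitching e)) i j) =
            Leonard.bracket q i (j - i : ℕ) (d - j : ℕ) *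
              algebraMap K L
                (Leonard.initialProd (Φ.firstSplit e) j *
                    (Φ.eta (j - i : ℕ)).eval (Φ.θ 0) /
                  Leonard.initialProd (Φ.secondSplit e) j)) ∧
    -- Leonard pairs in matrix form
    (∀ (θ θstar : Fin (d + 1) → K) (φ : Fin d → K),
      Function.Injective θ → Function.Injective θstar → (∀ k, φ k ≠ 0) →
      (Leonard.IsLeonardPair (Matrix.toLin' (Leonard.lowerBidiagonal θ))
          (Matrix.toLin' (Leonard.upperBidiagonal θstar φ)) ∨
        (Leonard.matrixData θ θstar φ).IsLeonardSystem) →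
      Leonard.IsBase θ q →
      ∀ (Φ : Leonard.LeonardData K (Matrix (Fin (d + 1)) (Fin (d + 1)) K) d),
        Φ = Leonard.matrixData θ θstar φ →
      ∀ (S : Matrix (Fin (d + 1)) (Fin (d + 1)) K),
        S = Φ.dualSwitching AlgEquiv.refl →
        IsUnit S ∧ S.BlockTriangular id ∧ (S⁻¹).BlockTriangular id ∧
        ∀ i j : Fin (d + 1), i ≤ j →
          algebraMap K L (S i j) =
            Leonard.bracket q i (j - i : ℕ) (d - j : ℕ) *
              algebraMap K L
                (Leonard.initialProd (Φ.secondSplit AlgEquiv.refl) i *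
                    (Φ.tau (j - i : ℕ)).eval (θ (Fin.last d)) /
                  Leonard.initialProd φ i) ∧
          algebraMap K L (S⁻¹ i j) =
            Leonard.bracket q i (j - i : ℕ) (d - j : ℕ) *
              algebraMap K L
                (Leonard.initialProd φ j * (Φ.eta (j - i : ℕ)).eval (θ 0) /
                  Leonard.initialProd (Φ.secondSplit AlgEquiv.refl) j)) := by
  refine ⟨?_, ?_⟩
  · intro 𝒜 _ _ e V _ _ _ _ _ Φ hΦ hq v hv ⟨u, hu⟩
    obtain ⟨c, hc⟩ := Leonard.exists_basis_of_isSimpleModule (V := V) e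
    have := Module.Finite.of_basis c
    -- Built from `e` and the basis `c`, so that it is both the module action and compatible with
    -- the trace defined through `e`.
    let ρ : 𝒜 ≃ₐ[K] Module.End K V := e.trans (LinearMap.toMatrixAlgEquiv c).symm
    have hρ : ∀ X, ρ X = Algebra.lsmul K K V X := fun X => by
      refine c.ext fun j => ?_
      simp only [ρ, AlgEquiv.trans_apply, Algebra.lsmul_coe, hc]
      rw [LinearMap.toMatrixAlgEquiv_symm, Matrix.toLinAlgEquiv_self]
    have htr : ∀ X, LinearMap.trace K V (ρ X) = Leonard.LeonardData.tr e X := fun X => by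
      rw [LinearMap.trace_eq_matrix_trace K c, Leonard.LeonardData.tr]
      congr 1
      exact (LinearMap.toMatrixAlgEquiv c).apply_symm_apply (e X)
    obtain ⟨w, ws, R⟩ := hΦ.exists_realizes (V := V) (ρ := ρ)
      (by rw [Module.finrank_eq_card_basis c, Fintype.card_fin]) htr
    have huv : ρ (Φ.Estar 0) u = v := by rw [hρ, hu]; rfl
    obtain ⟨ws', h0, R'⟩ := R.exists_start_eq hv
      (by rw [← huv]; exact Leonard.isEigenvector_of_mem_Estar R u)
    obtain ⟨b, hb, -, h⟩ := R'.exists_split_basis_switching hq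
    refine ⟨b, fun i => ?_, ?_⟩
    · rw [hb, h0, hρ]; rfl
    · simp only [hρ] at h
      exact h
  · intro θ θs φ hθ hθs hφ hLP hq Φ hΦ S hS
    let ρ : Matrix (Fin (d + 1)) (Fin (d + 1)) K ≃ₐ[K] Module.End K (Fin (d + 1) → K) :=
      Matrix.toLinAlgEquiv'
    have htr : ∀ X, LinearMap.trace K _ (ρ X) = Leonard.LeonardData.tr AlgEquiv.refl X :=
      fun X => Matrix.trace_toLin'_eq X
    have hsplit := Leonard.isSplitBasis_bidiagonal θ θs φ
    obtain ⟨w, ws, R⟩ : ∃ w ws, Leonard.Realizes Φ AlgEquiv.refl ρ w ws := by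
      rcases hLP with hLP | hLP
      · obtain ⟨w, ws, h⟩ := hsplit.exists_isEigenbasisPair hθ hθs hLP
        subst hΦ
        exact ⟨w, ws, htr, h, fun _ => rfl, fun _ => rfl⟩
      · subst hΦ
        exact hLP.exists_realizes (by simp) htr
    have hb0 : Pi.basisFun K (Fin (d + 1)) 0 ≠ 0 := (Pi.basisFun K (Fin (d + 1))).ne_zero 0
    have hsplit' : Leonard.IsSplitBasis (ρ Φ.A) (ρ Φ.Astar) Φ.θ Φ.θstar (fun _ => 1) φ
        (Pi.basisFun K (Fin (d + 1))) := by subst hΦ; exact hsplit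
    obtain ⟨ws', h0, R'⟩ := R.exists_start_eq hb0 hsplit'.B_zero
    obtain ⟨b, hb, -, h⟩ := R'.exists_split_basis_switching (q := q) (by subst hΦ; exact hq)
    -- The subdiagonal of `A` is `1`, so `τ_i(A)e_0 = e_i`: each matrix represents itself in the
    -- basis `b`.
    have hbb : b = Pi.basisFun K (Fin (d + 1)) := by
      refine Module.Basis.eq_of_apply_eq fun i => ?_
      rw [hb, h0, Leonard.map_aeval]
      exact (hsplit'.eq_aeval_tau i).symm
    have hmat : ∀ X, LinearMap.toMatrix b b (ρ X) = X := fun X => by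
      rw [hbb]
      exact LinearMap.toMatrix'_toLin' X
    simp only [hmat] at h
    rw [R'.firstSplit_eq hφ hsplit', ← hS, ← Matrix.nonsing_inv_eq_ringInverse] at h
    have hΦθ : Φ.θ = θ := by subst hΦ; rfl
    rw [← hΦθ]
    exact h
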